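/- **Setting.** Let $\mathcal G$ be a Galton--Watson tree with root $\rho$ whose offspring law has finite mean $b>1$; $b(\nu)$ is the number of offspring of $\nu$, and $\nu i$, $1\le i\le b(\nu)$, are its children. Let $\Sigma$ be a Polish space, $S'=(0,\infty)\times\Sigma$, and let $K$ be a Markov transition kernel on $S'$, with $m$-step kernels $K^{(m)}$. Given the tree, each vertex $\nu$ carries a state $\Gamma_\nu=(A_\nu,M_\nu)\in S'$: the root state $\Gamma_\rho$ has an arbitrary law, and, given the tree and the states up to generation $n$, the families $(\Gamma_{\nu i})_{1\le i\le b(\nu)}$ of the vertices $\nu$ of generation $n$ are independent, the law of the family of $\nu$ depends only on $b(\nu)$ and $\Gamma_\nu$, and each single $\Gamma_{\nu i}$ has law $K(\Gamma_\nu,\cdot)$ (siblings may be dependent). Thus along every line of descent the states form a Markov chain with kernel $K$. Adjoin a parent $\rho^{-1}$ to the root. Given the environment, the walk $\mathbf X$ starts at $\rho$ and moves from $\nu$ to its child $\nu i$ with probability $A_{\nu i}/(1+\sum_{j\le b(\nu)}A_{\nu j})$ and to its parent with probability $1/(1+\sum_{j\le b(\nu)}A_{\nu j})$; from $\rho^{-1}$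 it moves to $\rho$. The walk is called *transient* if, with positive probability (over the environment and the walk), it never returns to $\rho$. Let $(\Gamma_{\sigma_i})_{i\ge0}$, $\Gamma_{\sigma_i}=(A_{\sigma_i},M_{\sigma_i})$, be a Markov chain with kernel $K$ and $\sigma_0=\rho$. Given this chain, let $\mathbf X^{(\sigma)}$ be the nearest-neighbour walk on $\{-1,0,1,\dots\}$ started at $0$ that moves from $r\ge0$ to $r+1$ with probability $A_{\sigma_{r+1}}/(1+A_{\sigma_{r+1}})$ and to $r-1$ with probability $1/(1+A_{\sigma_{r+1}})$, and from $-1$ to $0$. Let $T_j$ be its first hitting time of $j$, and let $\mathbf P(T_{-1}>T_n\mid\Gamma_\rho=y)$ be averaged over both the chain started at $y$ and the walk. **Assumption 1.** There are integers $0<\ell\le N$ and a constant $\kappa\ge1$ such that $K^{(\ell)}(x,B)\le\frac{\kappa}{N}\sum_{m=1}^N K^{(m)}(y,B)$ for all $x,y\in S'$ and all Borel sets $B\subset S'$. **Assumption 2.** With $\eta_{\varepsilon,r}=1-\inf_{y\in S'}\mathbb P(\varepsilon<A_{\sigma_1}\le r\mid\Gamma_{\sigma_0}=y)$, one has $\liminf_{\varepsilon\downarrow0,\,r\to\infty}\eta_{\varepsilon,r}<1$.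 **Proposition.** Let Assumptions 1 and 2 hold, let $x^*\in[1,\infty)\times\Sigma$, and let $\beta=K^{(\ell)}(x^*,\cdot)$ with $\ell$ as in Assumption 1. If $$\liminf_{n\to\infty}\frac1n\int_{S'}\ln\mathbf P(T_{-1}>T_n\mid\Gamma_\rho=y)\,\beta(dy)>-\ln b,$$ where the integral of the non-positive integrand may equal $-\infty$, then $\mathbf X$ is transient. -/

import Mathlib

open MeasureTheory ProbabilityTheory Filter Topology
open scoped ENNReal NNReal

noncomputable section

namespace TreeWalk

/-! ### Markov chains on path space -/

section Chain

variable {E : Type*} [MeasurableSpace E]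

/-- The law on `ℕ → E` of the time-homogeneous Markov chain with initial law `μ₀` and transition
kernel `κ`. -/
def chainLaw (μ₀ : Measure E) (κ : Kernel E E) [IsMarkovKernel κ] : Measure (ℕ → E) :=
  Kernel.trajMeasure (X := fun _ => E) μ₀
    (fun n => κ.comap (fun h : (i : Finset.Iic n) → E => h ⟨n, Finset.mem_Iic.2 le_rfl⟩)
      (measurable_pi_apply _))

/-- The first time at which the path `x` is at `a`, with value `⊤` if this never happens. -/
def hitTime {V : Type*} (x : ℕ → V) (a : V) : ℕ∞ :=
  ⨅ (t : ℕ) (_ : x t = a), (t : ℕ∞)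

end Chain

/-! ### Branching Markov fields

Vertices of the Ulam–Harris tree are words `ν : List ℕ`. The root is `[]` and the `i`-th child of
`ν` is `i :: ν` (`i = 0, 1, …`), so that the parent of a word is its tail. -/

section Field

variable {E : Type*} [MeasurableSpace E]

/-- Words of length `n`. -/
abbrev Level (n : ℕ) : Type := {ν : List ℕ // ν.length = n}

/-- The parent of a word of length `n + 1`. -/
def Level.parent {n : ℕ} (μ : Level (n + 1)) : Level n :=
  ⟨μ.1.tail, by simp [μ.2]⟩

/-- The birth rank of a word of length `n + 1` among its siblings. -/
def Level.rank {n : ℕ} (μ : Level (n + 1)) : ℕ := μ.1.headI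

/-- Independent sampling, over all `ν : ι`, from the Markov kernel `L` started at `h ν`. -/
def productKernel (ι : Type*) {F : Type*} [MeasurableSpace F] (L : Kernel E F) [IsMarkovKernel L] :
    Kernel (ι → E) (ι → F) where
  toFun h := Measure.infinitePi (fun ν => L (h ν))
  measurable' := by
    refine Measurable.measure_of_isPiSystem_of_isProbabilityMeasure
      (generateFrom_squareCylinders (α := fun _ : ι => F)).symm
      (isPiSystem_squareCylinders (fun _ => MeasurableSpace.isPiSystem_measurableSet) (by simp)) ?_
    rintro _ ⟨s, t, ht, rfl⟩
    have ht' : ∀ i, MeasurableSet (t i) := fun i => by simpa using ht i (Set.mem_univ i)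
    simp_rw [fun h : ι → E => Measure.infinitePi_pi (fun ν => L (h ν)) (s := s) (t := t)
      (fun i _ => ht' i)]
    exact Finset.measurable_prod _ fun i _ =>
      (L.measurable_coe (ht' i)).comp (measurable_pi_apply i)

instance (ι : Type*) {F : Type*} [MeasurableSpace F] (L : Kernel E F) [IsMarkovKernel L] :
    IsMarkovKernel (productKernel ι L) :=
  ⟨fun h => inferInstanceAs (IsProbabilityMeasure (Measure.infinitePi (fun ν => L (h ν))))⟩

/-- Relabelling the families of the vertices of generation `n` as generation `n + 1`: the vertex
`i :: ν` receives the `i`-th entry of the family of `ν`. -/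
def relabel (n : ℕ) (f : Level n → ℕ → E) : Level (n + 1) → E :=
  fun μ => f μ.parent μ.rank

lemma measurable_relabel (n : ℕ) : Measurable (relabel (E := E) n) :=
  measurable_pi_iff.2 fun μ => (measurable_pi_apply μ.rank).comp (measurable_pi_apply μ.parent)

/-- One generation of a branching Markov field with family kernel `L`: given the values on
generations `0, …, n`, the families of the vertices `ν` of generation `n` are independent, the
family of `ν` having law `L (h ν)`, where `h ν` is the value at `ν`. -/
def generationKernel (L : Kernel E (ℕ → E)) [IsMarkovKernel L] (n : ℕ) :
    Kernel ((i : Finset.Iic n) → Level i → E) (Level (n + 1) → E) :=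
  ((productKernel (Level n) L).map (relabel n)).comap
    (fun h => h ⟨n, Finset.mem_Iic.2 le_rfl⟩) (measurable_pi_apply _)

instance (L : Kernel E (ℕ → E)) [IsMarkovKernel L] (n : ℕ) :
    IsMarkovKernel (generationKernel L n) := by
  have := Kernel.IsMarkovKernel.map (productKernel (Level n) L) (measurable_relabel n)
  unfold generationKernel
  infer_instance

/-- The law of the branching Markov field on `List ℕ` whose root value has law `μ₀` and whose
family kernel is `L`. -/
def branchingLaw (μ₀ : Measure E) (L : Kernel E (ℕ → E)) [IsMarkovKernel L] :
    Measure (List ℕ → E) :=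
  (Kernel.trajMeasure (X := fun n => Level n → E) (μ₀.map (fun x _ => x))
    (generationKernel L)).map (fun G ν => G ν.length ⟨ν, rfl⟩)

instance (μ₀ : Measure E) [IsProbabilityMeasure μ₀] (L : Kernel E (ℕ → E)) [IsMarkovKernel L] :
    IsProbabilityMeasure (branchingLaw μ₀ L) := by
  have : IsProbabilityMeasure (μ₀.map (fun (x : E) (_ : Level 0) => x)) :=
    Measure.isProbabilityMeasure_map (measurable_pi_iff.2 fun _ => measurable_id).aemeasurable
  exact Measure.isProbabilityMeasure_map (measurable_pi_iff.2 fun ν =>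
    (measurable_pi_apply (⟨ν, rfl⟩ : Level ν.length)).comp
      (measurable_pi_apply ν.length)).aemeasurable

end Field

/-! ### The environment -/

section Environment

/-- The state space `(0, ∞) × S` of `Γ = (A, M)`. -/
abbrev State (S : Type*) : Type _ := Set.Ioi (0 : ℝ) × S

variable {S : Type*}

/-- The weight component of a state. -/
def State.weight (x : State S) : ℝ := x.1.1

/-- An environment gives to each word its number of offspring and its state. Only the words that
can be reached from the root through existing children belong to the tree; the values at other
words play no role. -/
abbrev Env (S : Type*) : Type _ := List ℕ → ℕ × State S

/-- The number of offspring of `ν`. -/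
def Env.offspring (e : Env S) (ν : List ℕ) : ℕ := (e ν).1

/-- The weight `A_ν` on the edge between `ν` and its parent. -/
def Env.weight (e : Env S) (ν : List ℕ) : ℝ := (e ν).2.weight

variable [MeasurableSpace S]

/-- `J (k, x)` is the joint law of the states of the children `0, …, k - 1` of a vertex with `k`
offspring and state `x` (later coordinates are irrelevant). Siblings may be dependent, but each
single child of a vertex in state `x` has law `K x`. -/
def HasMarginals (J : Kernel (ℕ × State S) (ℕ → State S)) (K : Kernel (State S) (State S)) :
    Prop :=
  ∀ (k : ℕ) (x : State S) (i : ℕ), i < k → (J (k, x)).map (fun f => f i) = K x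

/-- The family kernel of the pair (offspring number, state): the children's offspring numbers are
i.i.d. with law `p`, independent of the children's states, which have joint law `J (k, x)`. -/
def familyKernel (p : PMF ℕ) (J : Kernel (ℕ × State S) (ℕ → State S)) :
    Kernel (ℕ × State S) (ℕ → ℕ × State S) :=
  ((Kernel.const (ℕ × State S) (Measure.infinitePi (fun _ : ℕ => p.toMeasure))) ×ₖ J).map
    (fun q i => (q.1 i, q.2 i))

instance (p : PMF ℕ) (J : Kernel (ℕ × State S) (ℕ → State S)) [IsMarkovKernel J] :
    IsMarkovKernel (familyKernel p J) :=
  Kernel.IsMarkovKernel.map _ (by fun_prop)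

/-- The law of the environment: a Galton–Watson tree with offspring law `p`; given the tree, the
root state has law `μ₀`, and, given the states up to generation `n`, the families of states of the
vertices of generation `n` are independent, that of `ν` having law `J (b(ν), Γ_ν)`. -/
def envLaw (p : PMF ℕ) (J : Kernel (ℕ × State S) (ℕ → State S)) [IsMarkovKernel J]
    (μ₀ : Measure (State S)) : Measure (Env S) :=
  branchingLaw (p.toMeasure.prod μ₀) (familyKernel p J)

instance (p : PMF ℕ) (J : Kernel (ℕ × State S) (ℕ → State S)) [IsMarkovKernel J]
    (μ₀ : Measure (State S)) [IsProbabilityMeasure μ₀] : IsProbabilityMeasure (envLaw p J μ₀) := by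
  unfold envLaw
  infer_instance

end Environment

/-! ### The random walk on the tree -/

section Walk

/-- The vertices of the tree, augmented by a parent `rootParent` of the root. -/
inductive Site : Type
  | rootParent : Site
  | vertex (ν : List ℕ) : Site

instance : MeasurableSpace Site := ⊤

/-- The parent of a vertex in the augmented tree. -/
def Site.parent : List ℕ → Site
  | [] => Site.rootParent
  | _ :: ν => Site.vertex ν

variable {S : Type*}

/-- `1 + ∑_i A_{νi}`, the sum being over the offspring of `ν`. -/
def Env.total (e : Env S) (ν : List ℕ) : ℝ :=
  1 + ∑ i ∈ Finset.range (e.offspring ν), e.weight (i :: ν)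

lemma Env.total_pos (e : Env S) (ν : List ℕ) : 0 < e.total ν :=
  add_pos_of_pos_of_nonneg one_pos (Finset.sum_nonneg fun i _ => (e (i :: ν)).2.1.2.le)

/-- The law of one step of the walk in the environment `e`. From `ν` the walk moves to the child
`i :: ν` with probability `A_{νi} / (1 + ∑_j A_{νj})` and to the parent with probability
`1 / (1 + ∑_j A_{νj})`; from the parent of the root it moves to the root. -/
def stepLaw (e : Env S) : Site → Measure Site
  | Site.rootParent => Measure.dirac (Site.vertex [])
  | Site.vertex ν =>
      ENNReal.ofReal (1 / e.total ν) • Measure.dirac (Site.parent ν) +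
        ∑ i ∈ Finset.range (e.offspring ν),
          ENNReal.ofReal (e.weight (i :: ν) / e.total ν) • Measure.dirac (Site.vertex (i :: ν))

/-- The transition kernel of the walk in the environment `e`. -/
def stepKernel (e : Env S) : Kernel Site Site where
  toFun := stepLaw e
  measurable' := measurable_from_top

instance (e : Env S) : IsMarkovKernel (stepKernel e) := by
  refine ⟨fun v => ⟨?_⟩⟩
  change stepLaw e v Set.univ = 1
  cases v with
  | rootParent => simp [stepLaw]
  | vertex ν =>
    have h0 := e.total_pos ν
    have hw : ∀ i, 0 ≤ e.weight (i :: ν) := fun i => (e (i :: ν)).2.1.2.le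
    simp only [stepLaw, Measure.add_apply, Measure.smul_apply, Measure.finsetSum_apply,
      measure_univ, smul_eq_mul, mul_one]
    rw [← ENNReal.ofReal_sum_of_nonneg (fun i _ => div_nonneg (hw i) h0.le),
      ← ENNReal.ofReal_add (by positivity)
        (Finset.sum_nonneg fun i _ => div_nonneg (hw i) h0.le),
      ← Finset.sum_div, ← add_div]
    change ENNReal.ofReal (e.total ν / e.total ν) = 1
    rw [div_self h0.ne', ENNReal.ofReal_one]

/-- The quenched law of the walk started at the root. -/
def quenchedLaw (e : Env S) : Measure (ℕ → Site) :=
  chainLaw (Measure.dirac (Site.vertex [])) (stepKernel e)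

/-- Transience when the environment has law `P`: with positive annealed probability, the walk
started at the root never returns to the root. -/
def IsTransient [MeasurableSpace S] (P : Measure (Env S)) : Prop :=
  0 < ∫⁻ e, quenchedLaw e {X | ∀ n : ℕ, 1 ≤ n → X n ≠ Site.vertex []} ∂P

end Walk

/-! ### The walk along a line of descent -/

section Ray

variable {S : Type*}

/-- The law of one step of the walk restricted to a line of descent with states `γ 0, γ 1, …` at
positions `0, 1, …`: from `r ≥ 0` it moves to `r + 1` with probability `A_{r+1} / (1 + A_{r+1})`
and to `r - 1` with probability `1 / (1 + A_{r+1})`. From position `-1` it moves to `0`; positions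
below `-1` are never visited by a walk started at `0`. -/
def rayStepLaw (γ : ℕ → State S) (r : ℤ) : Measure ℤ :=
  if 0 ≤ r then
    ENNReal.ofReal ((γ (r.toNat + 1)).weight / (1 + (γ (r.toNat + 1)).weight)) •
        Measure.dirac (r + 1) +
      ENNReal.ofReal (1 / (1 + (γ (r.toNat + 1)).weight)) • Measure.dirac (r - 1)
  else Measure.dirac (r + 1)

/-- The transition kernel of the walk restricted to a line of descent. -/
def rayStepKernel (γ : ℕ → State S) : Kernel ℤ ℤ where
  toFun := rayStepLaw γ
  measurable' := measurable_from_top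

instance (γ : ℕ → State S) : IsMarkovKernel (rayStepKernel γ) := by
  refine ⟨fun r => ⟨?_⟩⟩
  change rayStepLaw γ r Set.univ = 1
  unfold rayStepLaw
  split_ifs
  · have h : 0 < (γ (r.toNat + 1)).weight := (γ (r.toNat + 1)).1.2
    simp only [Measure.add_apply, Measure.smul_apply, measure_univ, smul_eq_mul, mul_one]
    rw [← ENNReal.ofReal_add (by positivity) (by positivity), ← add_div, add_comm,
      div_self (by positivity), ENNReal.ofReal_one]
  · simp

variable [MeasurableSpace S]

/-- The annealed probability `P(T_{-1} > T_n | Γ_ρ = y)`: the states along the line of descent form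
a Markov chain with kernel `K` started at `y`, and the walk starts at position `0`. -/
def hitProb (K : Kernel (State S) (State S)) [IsMarkovKernel K] (n : ℕ) (y : State S) : ℝ≥0∞ :=
  ∫⁻ γ, chainLaw (Measure.dirac (0 : ℤ)) (rayStepKernel γ)
    {x | hitTime x (-1) > hitTime x (n : ℤ)} ∂(chainLaw (Measure.dirac y) K)

/-- `∫ ln P(T_{-1} > T_n | Γ_ρ = y) β(dy)`, an integral in `[-∞, 0]` of a function with values in
`[-∞, 0]`. -/
def meanLogHit (K : Kernel (State S) (State S)) [IsMarkovKernel K] (n : ℕ)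
    (β : Measure (State S)) : EReal :=
  -((∫⁻ y, (-ENNReal.log (hitProb K n y)).toENNReal ∂β : ℝ≥0∞) : EReal)

/-- The uniform domination condition on the convolution powers of `K`. -/
structure Assumption1 (K : Kernel (State S) (State S)) (ℓ N : ℕ) (κ : ℝ≥0) : Prop where
  pos : 0 < ℓ
  le : ℓ ≤ N
  one_le : 1 ≤ κ
  bound : ∀ (x y : State S) (B : Set (State S)), MeasurableSet B →
    (K ^ ℓ) x B ≤ (κ : ℝ≥0∞) / N * ∑ m ∈ Finset.Icc 1 N, (K ^ m) y B

/-- `η_{ε,r} = 1 - inf_y P(ε < A_{σ_1} ≤ r | Γ_{σ_0} = y)`. -/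
def eta (K : Kernel (State S) (State S)) (ε r : ℝ) : ℝ≥0∞ :=
  1 - ⨅ y : State S, K y {z | ε < z.weight ∧ z.weight ≤ r}

/-- `liminf_{ε ↓ 0, r → ∞} η_{ε,r} < 1`. -/
def Assumption2 (K : Kernel (State S) (State S)) : Prop :=
  liminf (fun q : ℝ × ℝ => eta K q.1 q.2) (𝓝[>] 0 ×ˢ atTop) < 1

end Ray

end TreeWalk

end

namespace TreeWalk

/-! ### The Markov property of trajectory laws -/

section Traj

variable {X : ℕ → Type*} [∀ n, MeasurableSpace (X n)]

/-! Read the environment as an electrical network: the edge above the root has resistance 1, and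
every further edge has the resistance of the preceding edge divided by its weight. Along one line of
descent, gambler's ruin bounds the probability of reaching n before -1 by 1/R, where R is the
resistance between -1 and n. Hence `hitProb K n y` is at most `meanCond K n 0 1 y`, the mean of 1/R
(`hitProb_le_meanCond`).

The hypothesis controls only the β-mean of a logarithm. Markov's inequality turns it into a bound
exp(-t n) for `meanCond K n 0 1`, with t < log b, on a set whose β-mass is bounded below
independently of n. By the two assumptions a chain started anywhere enters this set after at most ℓ
+ N steps, through weights above a fixed ε, with probability bounded below. These boundedly many
extra edges cost a constant factor, so c exp(-t n) is a lower bound from every state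
(`exists_uniform_bound`, `exists_exp_lower_bound`).

Now cut the offspring numbers at D so that their mean still exceeds exp t. For some n, the n-th
power of the cut mean times `meanCond K n 0 1 y` is at least 2 for all y. Let a vertex of generation
n succeed with probability t (now a function of its subtree), and send the flow t/R to it. Thomson's
principle gives: flow ≤ escape probability + sum over pairs of distinct vertices
(`rayFlow_le_escapeProb_add`). If t has mean q from every state, the flow has mean at least 2q and
the pair sum has mean at most C q². So the escape probability has mean at least q as soon as C q ≤
1. Thinning it back to mean exactly q allows the step to be repeated, block of n generations after
block (`exists_lintegral_escapeProb_ge`).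

The resulting lower bound does not depend on the depth. In the limit the conductance to infinity is
positive with positive probability, and `le_quenchedLaw` converts this into a positive probability
of no return. Dependent siblings do no harm: first moments see only the marginals K, and the pair
bound is uniform in the states of the two siblings. -/

lemma lintegral_trajMeasure_succ (μ₀ : Measure (X 0)) [IsProbabilityMeasure μ₀]
    (κ : (n : ℕ) → Kernel ((i : Finset.Iic n) → X i) (X (n + 1))) [∀ n, IsMarkovKernel (κ n)]
    (n : ℕ) (G : ((i : Finset.Iic n) → X i) × X (n + 1) → ℝ≥0∞) (hG : Measurable G) :
    ∫⁻ x, G (Preorder.frestrictLe n x, x (n + 1)) ∂(Kernel.trajMeasure μ₀ κ) =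
      ∫⁻ x, ∫⁻ z, G (Preorder.frestrictLe n x, z) ∂(κ n (Preorder.frestrictLe n x))
        ∂(Kernel.trajMeasure μ₀ κ) := by
  have h := Kernel.map_frestrictLe_trajMeasure_compProd_eq_map_trajMeasure (μ₀ := μ₀) (κ := κ)
    (a := n)
  have h1 : Measurable fun x : (n : ℕ) → X n => (Preorder.frestrictLe n x, x (n + 1)) := by fun_prop
  rw [← lintegral_map (f := G) hG h1, ← h, Measure.lintegral_compProd hG, lintegral_map]
  · exact hG.lintegral_kernel_prod_right'
  · fun_prop

lemma trajMeasure_map_frestrictLe_zero (μ₀ : Measure (X 0))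
    (κ : (n : ℕ) → Kernel ((i : Finset.Iic n) → X i) (X (n + 1))) [∀ n, IsMarkovKernel (κ n)] :
    (Kernel.trajMeasure μ₀ κ).map (fun x => x 0) = μ₀ := by
  have e1 : (fun x : (n : ℕ) → X n => x 0) =
      (fun y : (i : Finset.Iic 0) → X i => y ⟨0, Finset.mem_Iic.2 le_rfl⟩) ∘
        Preorder.frestrictLe 0 := rfl
  rw [e1, ← Measure.map_map (measurable_pi_apply _) (by fun_prop), Kernel.trajMeasure,
    Measure.map_comp _ _ (by fun_prop), Kernel.traj_map_frestrictLe, Kernel.partialTraj_self,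
    Measure.id_comp]
  exact (Measure.map_map (measurable_pi_apply _) (MeasurableEquiv.measurable _)).trans Measure.map_id

end Traj

section Chain

variable {E : Type*} [MeasurableSpace E]

instance (μ₀ : Measure E) [IsProbabilityMeasure μ₀] (κ : Kernel E E) [IsMarkovKernel κ] :
    IsProbabilityMeasure (chainLaw μ₀ κ) := by
  unfold chainLaw
  infer_instance

lemma chainLaw_lintegral_succ (μ₀ : Measure E) [IsProbabilityMeasure μ₀] (κ : Kernel E E)
    [IsMarkovKernel κ] (n : ℕ) (G : (ℕ → E) → E → ℝ≥0∞) (hG : Measurable (Function.uncurry G))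
    (hdep : ∀ x x' z, (∀ i ≤ n, x i = x' i) → G x z = G x' z) :
    ∫⁻ x, G x (x (n + 1)) ∂(chainLaw μ₀ κ) =
      ∫⁻ x, ∫⁻ z, G x z ∂(κ (x n)) ∂(chainLaw μ₀ κ) := by
  -- Any measurable extension of the initial segment would do; here the path is frozen after time n,
  -- and `hdep` makes the choice irrelevant.
  let ex : ((i : Finset.Iic n) → E) → ℕ → E :=
    fun y i => y ⟨min i n, Finset.mem_Iic.2 (min_le_right _ _)⟩
  have hex : Measurable ex := measurable_pi_iff.2 fun i => measurable_pi_apply _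
  have h := lintegral_trajMeasure_succ (X := fun _ => E) μ₀
    (fun n => κ.comap (fun h : (i : Finset.Iic n) → E => h ⟨n, Finset.mem_Iic.2 le_rfl⟩)
      (measurable_pi_apply _)) n (fun q => G (ex q.1) q.2)
      (hG.comp ((hex.comp measurable_fst).prodMk measurable_snd))
  have h2 : ∀ (x : ℕ → E) z, G (ex (Preorder.frestrictLe n x)) z = G x z := by
    intro x z
    refine hdep _ _ z fun i hi => ?_
    change x (min i n) = x i
    rw [min_eq_left hi]
  simp only [h2] at h
  exact h

lemma chainLaw_map_zero (μ₀ : Measure E) (κ : Kernel E E)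
    [IsMarkovKernel κ] : (chainLaw μ₀ κ).map (fun x => x 0) = μ₀ :=
  trajMeasure_map_frestrictLe_zero (X := fun _ => E) μ₀ _

lemma chainLaw_dirac_lintegral_zero (v : E) (κ : Kernel E E) [IsMarkovKernel κ] (f : E → ℝ≥0∞)
    (hf : Measurable f) : ∫⁻ x, f (x 0) ∂(chainLaw (Measure.dirac v) κ) = f v := by
  rw [← lintegral_map (f := f) hf (measurable_pi_apply 0), chainLaw_map_zero, lintegral_dirac' _ hf]

end Chain

/-! ### Bounds by superharmonic and subharmonic functions -/

section Harmonic

lemma exists_of_hitTime_lt {V : Type*} (x : ℕ → V) (a c : V) (h : hitTime x a < hitTime x c) :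
    ∃ t, x t = a ∧ ∀ r ≤ t, x r ≠ c := by
  unfold hitTime at h
  rw [iInf_lt_iff] at h
  obtain ⟨t, ht⟩ := h
  rw [iInf_lt_iff] at ht
  obtain ⟨hta, ht⟩ := ht
  refine ⟨t, hta, fun r hr hc => ?_⟩
  have : (t : ℕ∞) < r := ht.trans_le (iInf₂_le r hc)
  exact absurd (Nat.cast_lt.1 this) (not_lt.2 hr)

variable {V : Type*} [MeasurableSpace V] [DiscreteMeasurableSpace V]

open Classical in
/-- A function that is at least `1` at `a` and superharmonic off `a` and `c` bounds the probability
to visit `a` strictly before `c`. -/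
lemma chainLaw_hitTime_le (κ : Kernel V V) [IsMarkovKernel κ] (v a c : V) (h : V → ℝ≥0∞)
    (ha : 1 ≤ h a) (hs : ∀ w, w ≠ a → w ≠ c → ∫⁻ z, h z ∂(κ w) ≤ h w) :
    chainLaw (Measure.dirac v) κ {x | hitTime x c > hitTime x a} ≤ h v := by
  set P := chainLaw (Measure.dirac v) κ
  have hh : Measurable h := measurable_from_top.mono (fun s _ => MeasurableSet.of_discrete) le_rfl
  let E : ℕ → Set (ℕ → V) := fun t => {x | ∃ s ≤ t, x s = a ∧ ∀ r ≤ s, x r ≠ c}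
  let D : ℕ → Set (ℕ → V) := fun t => {x | ∀ s ≤ t, x s ≠ a ∧ x s ≠ c}
  have hpt : ∀ (s : ℕ) (q : V), MeasurableSet {x : ℕ → V | x s = q} := fun s q =>
    measurableSet_preimage (f := fun x : ℕ → V => x s) (measurable_pi_apply s)
      (MeasurableSet.of_discrete (s := {q}))
  have hE : ∀ t, MeasurableSet (E t) := fun t => by
    have : E t = ⋃ s, ⋃ (_ : s ≤ t), ({x | x s = a} ∩ ⋂ r, ⋂ (_ : r ≤ s), {x | x r = c}ᶜ) := by
      ext x; simp [E, and_left_comm]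
    rw [this]
    exact MeasurableSet.iUnion fun s => MeasurableSet.iUnion fun _ => (hpt s a).inter
      (MeasurableSet.iInter fun r => MeasurableSet.iInter fun _ => (hpt r c).compl)
  have hD : ∀ t, MeasurableSet (D t) := fun t => by
    have : D t = ⋂ s, ⋂ (_ : s ≤ t), ({x | x s = a}ᶜ ∩ {x | x s = c}ᶜ) := by
      ext x; simp [D]
    rw [this]
    exact MeasurableSet.iInter fun r => MeasurableSet.iInter fun _ => (hpt r a).compl.inter (hpt r c).compl
  -- The stopped process: 1 once `a` has been reached before `c`, the value of `h` while neither has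
  -- been visited, and 0 once `c` has come first. Its mean does not increase in t.
  let Φ : ℕ → (ℕ → V) → ℝ≥0∞ := fun t x => (E t).indicator 1 x + (D t).indicator 1 x * h (x t)
  have hΦ : ∀ t, ∫⁻ x, Φ t x ∂P ≤ h v := by
    intro t
    induction t with
    | zero =>
      rw [← chainLaw_dirac_lintegral_zero v κ h hh]
      refine lintegral_mono fun x => ?_
      by_cases hx : x 0 = a
      · have hd : x ∉ D 0 := fun hd => (hd 0 le_rfl).1 hx
        have h1 : (E 0).indicator (1 : (ℕ → V) → ℝ≥0∞) x ≤ 1 := Set.indicator_le_self' (by simp) x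
        simp only [Φ, Set.indicator_of_notMem hd, zero_mul, add_zero]
        rw [hx]
        exact h1.trans ha
      · have he : x ∉ E 0 := by
          rintro ⟨s, hs, hsa, -⟩
          obtain rfl : s = 0 := by omega
          exact hx hsa
        simp only [Φ, Set.indicator_of_notMem he, zero_add]
        calc _ ≤ 1 * h (x 0) := by
              gcongr
              exact Set.indicator_le_self' (by simp) x
          _ = h (x 0) := one_mul _
    | succ t ih =>
      have step : ∀ x, Φ (t + 1) x ≤ (E t).indicator 1 x + (D t).indicator 1 x * h (x (t + 1)) := by
        intro x
        by_cases h1 : x ∈ D (t + 1)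
        · have h2 : x ∈ D t := fun s hs => h1 s (by omega)
          have h3 : x ∉ E (t + 1) := fun ⟨s, hs, hsa, _⟩ => (h1 s hs).1 hsa
          simp [Φ, h1, h2, h3]
        · by_cases h2 : x ∈ E t
          · have h3 : x ∈ E (t + 1) := by
              obtain ⟨s, hs, h⟩ := h2
              exact ⟨s, by omega, h⟩
            simp [Φ, h1, h2, h3]
          · by_cases h3 : x ∈ E (t + 1)
            · obtain ⟨s, hs, hsa, hsc⟩ := h3
              have hst : s = t + 1 := by
                by_contra hne
                exact h2 ⟨s, by omega, hsa, hsc⟩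
              subst hst
              have h4 : x ∈ D t := by
                intro r hr
                refine ⟨fun hra => h2 ⟨r, hr, hra, fun q hq => hsc q (by omega)⟩, hsc r (by omega)⟩
              have h3 : x ∈ E (t + 1) := ⟨t + 1, le_rfl, hsa, hsc⟩
              simp only [Φ, Set.indicator_of_mem h3, Set.indicator_of_notMem h1,
                Set.indicator_of_notMem h2, Set.indicator_of_mem h4, hsa]
              simpa using ha
            · simp [Φ, h1, h3]
      have hmark := chainLaw_lintegral_succ (Measure.dirac v) κ t
        (fun x z => (E t).indicator 1 x + (D t).indicator 1 x * h z)
        (by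
          refine Measurable.add ?_ (Measurable.mul ?_ (hh.comp measurable_snd))
          · exact (measurable_one.indicator (hE t)).comp measurable_fst
          · exact (measurable_one.indicator (hD t)).comp measurable_fst)
        (by
          intro x x' z hxx
          have e1 : x ∈ E t ↔ x' ∈ E t := by
            constructor
            · rintro ⟨s, hs, h1, h2⟩
              exact ⟨s, hs, hxx s hs ▸ h1, fun r hr => hxx r (hr.trans hs) ▸ h2 r hr⟩
            · rintro ⟨s, hs, h1, h2⟩
              exact ⟨s, hs, (hxx s hs).symm ▸ h1, fun r hr => (hxx r (hr.trans hs)).symm ▸ h2 r hr⟩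
          have e2 : x ∈ D t ↔ x' ∈ D t := by
            simp only [D, Set.mem_ofPred_eq]
            refine forall₂_congr fun s hs => ?_
            rw [hxx s hs]
          simp only [Set.indicator_apply, e1, e2, Pi.one_apply])
      calc ∫⁻ x, Φ (t + 1) x ∂P
          ≤ ∫⁻ x, (E t).indicator 1 x + (D t).indicator 1 x * h (x (t + 1)) ∂P :=
            lintegral_mono step
        _ = ∫⁻ x, ∫⁻ z, (E t).indicator 1 x + (D t).indicator 1 x * h z ∂(κ (x t)) ∂P := hmark
        _ ≤ ∫⁻ x, Φ t x ∂P := by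
            refine lintegral_mono fun x => ?_
            rw [lintegral_add_left measurable_const, lintegral_const_mul _ hh]
            simp only [lintegral_const, measure_univ, mul_one, Φ]
            by_cases hx : x ∈ D t
            · have := hs (x t) (hx t le_rfl).1 (hx t le_rfl).2
              gcongr
            · simp [hx]
        _ ≤ h v := ih
  have hsub : {x : ℕ → V | hitTime x c > hitTime x a} ⊆ ⋃ t, E t := fun x hx => by
    obtain ⟨t, h1, h2⟩ := exists_of_hitTime_lt x a c hx
    exact Set.mem_iUnion.2 ⟨t, t, le_rfl, h1, h2⟩
  have hmono : Monotone E := fun s t hst x ⟨r, hr, h⟩ => ⟨r, hr.trans hst, h⟩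
  refine (measure_mono hsub).trans ?_
  rw [hmono.measure_iUnion]
  refine iSup_le fun t => le_trans ?_ (hΦ t)
  rw [← lintegral_indicator_one (hE t)]
  exact lintegral_mono fun x => le_self_add

/-- A function bounded by `1` that vanishes at `o` and is subharmonic off `o` bounds from below the
probability never to return to `o`. -/
lemma le_chainLaw_no_return (κ : Kernel V V) [IsMarkovKernel κ] (o : V) (f : V → ℝ≥0∞)
    (hf1 : ∀ w, f w ≤ 1) (hfo : f o = 0) (hs : ∀ w, w ≠ o → f w ≤ ∫⁻ z, f z ∂(κ w)) :
    ∫⁻ z, f z ∂(κ o) ≤ chainLaw (Measure.dirac o) κ {x | ∀ n : ℕ, 1 ≤ n → x n ≠ o} := by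
  set P := chainLaw (Measure.dirac o) κ
  have hf : Measurable f := measurable_from_top.mono (fun s _ => MeasurableSet.of_discrete) le_rfl
  let D : ℕ → Set (ℕ → V) := fun t => {x | ∀ s ≤ t, 1 ≤ s → x s ≠ o}
  have hpt : ∀ (s : ℕ) (q : V), MeasurableSet {x : ℕ → V | x s = q} := fun s q =>
    measurableSet_preimage (f := fun x : ℕ → V => x s) (measurable_pi_apply s)
      (MeasurableSet.of_discrete (s := {q}))
  have hD : ∀ t, MeasurableSet (D t) := fun t => by
    have : D t = ⋂ s, ⋂ (_ : s ≤ t), ⋂ (_ : 1 ≤ s), {x | x s = o}ᶜ := by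
      ext x; simp [D]
    rw [this]
    exact MeasurableSet.iInter fun r => MeasurableSet.iInter fun _ => MeasurableSet.iInter fun _ =>
      (hpt r o).compl
  have hdep : ∀ t x x', (∀ i ≤ t, x i = x' i) → (x ∈ D t ↔ x' ∈ D t) := by
    intro t x x' hxx
    simp only [D, Set.mem_ofPred_eq]
    refine forall₂_congr fun s hs => ?_
    rw [hxx s hs]
  have hmark : ∀ t, ∫⁻ x, (D t).indicator 1 x * f (x (t + 1)) ∂P =
      ∫⁻ x, (D t).indicator 1 x * ∫⁻ z, f z ∂(κ (x t)) ∂P := by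
    intro t
    have := chainLaw_lintegral_succ (Measure.dirac o) κ t
      (fun x z => (D t).indicator 1 x * f z)
      (Measurable.mul ((measurable_one.indicator (hD t)).comp measurable_fst)
        (hf.comp measurable_snd))
      (by
        intro x x' z hxx
        classical
        simp only [Set.indicator_apply, hdep t x x' hxx, Pi.one_apply])
    rw [this]
    exact lintegral_congr fun x => lintegral_const_mul _ hf
  -- The mean of `f` at time t + 1 on the event of no return up to time t is nondecreasing in t:
  -- since `f` vanishes at `o`, discarding the paths that are at `o` at time t + 1 loses nothing.
  have key : ∀ t, ∫⁻ z, f z ∂(κ o) ≤ ∫⁻ x, (D t).indicator 1 x * f (x (t + 1)) ∂P := by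
    intro t
    induction t with
    | zero =>
      rw [hmark 0, ← chainLaw_dirac_lintegral_zero o κ (fun w => ∫⁻ z, f z ∂(κ w))
        (hf.lintegral_kernel)]
      refine lintegral_mono fun x => ?_
      have : x ∈ D 0 := fun s hs h1 => by omega
      simp [this]
    | succ t ih =>
      refine ih.trans ?_
      rw [hmark (t + 1)]
      refine lintegral_mono fun x => ?_
      by_cases hx : x ∈ D t
      · by_cases ho : x (t + 1) = o
        · simp [ho, hfo]
        · have h1 : x ∈ D (t + 1) := fun s hs h1 => by
            rcases Nat.lt_or_ge t s with h | h
            · obtain rfl : s = t + 1 := by omega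
              exact ho
            · exact hx s h h1
          simpa [hx, h1] using hs _ ho
      · simp [hx]
  have hset : {x : ℕ → V | ∀ n : ℕ, 1 ≤ n → x n ≠ o} = ⋂ t, D t := by
    ext x
    simp only [D, Set.mem_ofPred_eq, Set.mem_iInter]
    exact ⟨fun h t s _ h1 => h s h1, fun h n h1 => h n n le_rfl h1⟩
  have hanti : Antitone D := fun s t hst x hx r hr => hx r (hr.trans hst)
  rw [hset, hanti.measure_iInter (fun t => (hD t).nullMeasurableSet) ⟨0, measure_ne_top _ _⟩]
  refine le_iInf fun t => (key t).trans ?_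
  rw [← lintegral_indicator_one (hD t)]
  refine lintegral_mono fun x => ?_
  calc (D t).indicator 1 x * f (x (t + 1)) ≤ (D t).indicator (1 : (ℕ → V) → ℝ≥0∞) x * 1 := by
        gcongr
        exact hf1 _
    _ = _ := mul_one _

end Harmonic

/-! ### Resistances along a line of descent -/

section RayResistance

variable {S : Type*}

lemma State.weight_pos (x : State S) : 0 < x.weight := x.1.2

/-- The resistance of the edge between positions `r - 1` and `r`. -/
noncomputable def rayEdge (γ : ℕ → State S) (r : ℕ) : ℝ :=
  ∏ i ∈ Finset.range r, ((γ (i + 1)).weight)⁻¹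

/-- The resistance between positions `-1` and `r - 1`. -/
noncomputable def rayResistance (γ : ℕ → State S) (r : ℕ) : ℝ := ∑ i ∈ Finset.range r, rayEdge γ i

lemma rayEdge_pos (γ : ℕ → State S) (r : ℕ) : 0 < rayEdge γ r :=
  Finset.prod_pos fun _ _ => inv_pos.2 (State.weight_pos _)

lemma rayEdge_succ (γ : ℕ → State S) (r : ℕ) :
    rayEdge γ (r + 1) = rayEdge γ r / (γ (r + 1)).weight := by
  rw [rayEdge, Finset.prod_range_succ, div_eq_mul_inv, rayEdge]

lemma rayResistance_succ (γ : ℕ → State S) (r : ℕ) :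
    rayResistance γ (r + 1) = rayResistance γ r + rayEdge γ r := Finset.sum_range_succ _ _

lemma rayResistance_nonneg (γ : ℕ → State S) (r : ℕ) : 0 ≤ rayResistance γ r :=
  Finset.sum_nonneg fun _ _ => (rayEdge_pos γ _).le

lemma rayResistance_succ_pos (γ : ℕ → State S) (r : ℕ) : 0 < rayResistance γ (r + 1) := by
  rw [rayResistance_succ]
  exact add_pos_of_nonneg_of_pos (rayResistance_nonneg γ r) (rayEdge_pos γ r)

/-- Gambler's ruin: the resistance from -1 to r, divided by the resistance from -1 to n, is harmonic
at every r ≥ 0, equals 1 at n and vanishes at -1. Truncation at 1 keeps it superharmonic. The upper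
bound alone is enough for the theorem. -/
lemma ray_hit_le (γ : ℕ → State S) (n : ℕ) :
    chainLaw (Measure.dirac (0 : ℤ)) (rayStepKernel γ)
      {x | hitTime x (-1) > hitTime x (n : ℤ)} ≤ ENNReal.ofReal (1 / rayResistance γ (n + 1)) := by
  set R := rayResistance γ (n + 1)
  have hR : 0 < R := rayResistance_succ_pos γ n
  -- The shift by one is due to `rayResistance γ r` ending at position r - 1.
  let g : ℤ → ℝ := fun r => min 1 (rayResistance γ (r + 1).toNat / R)
  have g0 : ∀ r, 0 ≤ g r := fun r =>
    le_min zero_le_one (div_nonneg (rayResistance_nonneg γ _) hR.le)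
  have hneg : ∀ r : ℤ, r < 0 → g r = 0 := by
    intro r hr
    have : (r + 1).toNat = 0 := by omega
    simp [g, this, rayResistance]
  have key := chainLaw_hitTime_le (rayStepKernel γ) (0 : ℤ) (n : ℤ) (-1)
    (fun r => ENNReal.ofReal (g r)) ?_ ?_
  · refine key.trans (ENNReal.ofReal_le_ofReal ((min_le_right _ _).trans_eq ?_))
    simp [rayResistance, rayEdge]
  · have : ((n : ℤ) + 1).toNat = n + 1 := by omega
    simp only [g, this]
    rw [div_self hR.ne']
    simp
  · intro w _ hw
    change ∫⁻ z, ENNReal.ofReal (g z) ∂(rayStepLaw γ w) ≤ _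
    unfold rayStepLaw
    split_ifs with h0
    · obtain ⟨m, rfl⟩ := Int.eq_ofNat_of_zero_le h0
      have hA := State.weight_pos (γ (m + 1))
      set A := (γ (m + 1)).weight
      simp only [lintegral_add_measure, lintegral_smul_measure, lintegral_dirac, smul_eq_mul,
        Int.toNat_natCast]
      rw [← ENNReal.ofReal_mul (by positivity), ← ENNReal.ofReal_mul (by positivity),
        ← ENNReal.ofReal_add (mul_nonneg (by positivity) (g0 _))
          (mul_nonneg (by positivity) (g0 _))]
      refine ENNReal.ofReal_le_ofReal ?_
      have e1 : ((m : ℤ) + 1 + 1).toNat = m + 1 + 1 := by omega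
      have e2 : ((m : ℤ) - 1 + 1).toNat = m := by omega
      have e3 : ((m : ℤ) + 1).toNat = m + 1 := by omega
      simp only [g, e1, e2, e3]
      have hp : A / (1 + A) + 1 / (1 + A) = 1 := by field_simp; ring
      have hp0 : 0 ≤ A / (1 + A) := by positivity
      have hq0 : 0 ≤ 1 / (1 + A) := by positivity
      refine le_min ?_ ?_
      · calc _ ≤ A / (1 + A) * 1 + 1 / (1 + A) * 1 := by
              gcongr <;> exact min_le_left _ _
          _ = 1 := by rw [mul_one, mul_one, hp]
      · calc _ ≤ A / (1 + A) * (rayResistance γ (m + 1 + 1) / R) +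
              1 / (1 + A) * (rayResistance γ m / R) := by
              gcongr <;> exact min_le_right _ _
          _ = rayResistance γ (m + 1) / R := by
              rw [rayResistance_succ γ (m + 1), rayEdge_succ, rayResistance_succ γ m]
              change A / (1 + A) * ((rayResistance γ m + rayEdge γ m + rayEdge γ m / A) / R) + _ = _
              field_simp
              ring
    · have h1 : w + 1 < 0 := by omega
      simp [hneg (w + 1) h1]

end RayResistance

/-! ### Mean conductance along a random line of descent. -/

section MeanConductance

variable {S : Type*} [MeasurableSpace S]

lemma measurable_weight : Measurable (State.weight : State S → ℝ) :=
  measurable_subtype_coe.comp measurable_fst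

/-- The mean, over a Markov chain `γ` with kernel `K` started at `y`, of
`1 / (a + c * (1 + A₁⁻¹ + ⋯ + (A₁ ⋯ Aₙ)⁻¹))`. -/
noncomputable def meanCond (K : Kernel (State S) (State S)) : ℕ → ℝ → ℝ → State S → ℝ≥0∞
  | 0, a, c, _ => ENNReal.ofReal (1 / (a + c))
  | n + 1, a, c, y => ∫⁻ z, meanCond K n (a + c) (c / z.weight) z ∂(K y)

lemma measurable_meanCond (K : Kernel (State S) (State S)) [IsMarkovKernel K] (n : ℕ) :
    Measurable fun q : ℝ × ℝ × State S => meanCond K n q.1 q.2.1 q.2.2 := by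
  induction n with
  | zero =>
    simp only [meanCond]
    fun_prop
  | succ n ih =>
    simp only [meanCond]
    let K' : Kernel (ℝ × ℝ × State S) (State S) := K.comap (fun q => q.2.2) (by fun_prop)
    have h : Measurable fun r : (ℝ × ℝ × State S) × State S =>
        meanCond K n (r.1.1 + r.1.2.1) (r.1.2.1 / r.2.weight) r.2 := by
      refine ih.comp (f := fun r : (ℝ × ℝ × State S) × State S =>
        (r.1.1 + r.1.2.1, r.1.2.1 / r.2.weight, r.2)) ?_
      have : Measurable fun r : (ℝ × ℝ × State S) × State S => r.2.weight :=
        measurable_weight.comp measurable_snd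
      refine Measurable.prodMk (by fun_prop) (Measurable.prodMk (Measurable.div (by fun_prop) this)
        measurable_snd)
    exact h.lintegral_kernel_prod_right' (κ := K')

lemma measurable_rayEdge (r : ℕ) : Measurable fun γ : ℕ → State S => rayEdge γ r :=
  Finset.measurable_prod _ fun i _ => (measurable_weight.comp (measurable_pi_apply (i + 1))).inv

lemma measurable_rayResistance (r : ℕ) : Measurable fun γ : ℕ → State S => rayResistance γ r :=
  Finset.measurable_sum _ fun i _ => measurable_rayEdge i

/-- One unfolding of `meanCond` is one use of the Markov property, the parameters `a` and `c` being
the resistance accumulated so far and the current edge. The position j is kept free so that the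
induction on m can advance along the path. -/
lemma lintegral_meanCond_chain (K : Kernel (State S) (State S)) [IsMarkovKernel K]
    (y : State S) (m j : ℕ) :
    ∫⁻ γ, meanCond K m (rayResistance γ j) (rayEdge γ j) (γ j) ∂(chainLaw (Measure.dirac y) K) =
      ∫⁻ γ, ENNReal.ofReal (1 / rayResistance γ (j + m + 1))
        ∂(chainLaw (Measure.dirac y) K) := by
  induction m generalizing j with
  | zero => simp [meanCond, rayResistance_succ]
  | succ m ih =>
    have h := chainLaw_lintegral_succ (Measure.dirac y) K j
      (fun γ z => meanCond K m (rayResistance γ j + rayEdge γ j) (rayEdge γ j / z.weight) z)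
      (by
        refine (measurable_meanCond K m).comp (f := fun r : (ℕ → State S) × State S =>
          (rayResistance r.1 j + rayEdge r.1 j, rayEdge r.1 j / r.2.weight, r.2)) ?_
        have h1 : Measurable fun r : (ℕ → State S) × State S => r.2.weight :=
          measurable_weight.comp measurable_snd
        have h2 : Measurable fun r : (ℕ → State S) × State S => rayEdge r.1 j :=
          (measurable_rayEdge j).comp measurable_fst
        have h3 : Measurable fun r : (ℕ → State S) × State S => rayResistance r.1 j :=
          (measurable_rayResistance j).comp measurable_fst
        exact (h3.add h2).prodMk ((h2.div h1).prodMk measurable_snd))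
      (by
        intro γ γ' z hγ
        have e1 : ∀ i ≤ j, rayEdge γ i = rayEdge γ' i := fun i hi =>
          Finset.prod_congr rfl fun k hk => by rw [hγ (k + 1) (by
            have := Finset.mem_range.1 hk; omega)]
        have e2 : rayResistance γ j = rayResistance γ' j :=
          Finset.sum_congr rfl fun k hk => e1 k (Finset.mem_range.1 hk).le
        rw [e1 j le_rfl, e2])
    simp only [← rayEdge_succ, ← rayResistance_succ] at h
    simp only [meanCond]
    simp only [rayEdge_succ, ← rayResistance_succ] at h ⊢
    rw [← h]
    have := ih (j + 1)
    simp only [rayEdge_succ] at this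
    rw [this]
    congr 1
    ext γ
    congr 4
    omega

lemma hitProb_le_meanCond (K : Kernel (State S) (State S)) [IsMarkovKernel K] (n : ℕ)
    (y : State S) : hitProb K n y ≤ meanCond K n 0 1 y := by
  have h := lintegral_meanCond_chain K y n 0
  have h0 : ∀ γ : ℕ → State S, rayResistance γ 0 = 0 := fun γ => by simp [rayResistance]
  have h1 : ∀ γ : ℕ → State S, rayEdge γ 0 = 1 := fun γ => by simp [rayEdge]
  simp only [h0, h1, zero_add] at h
  rw [chainLaw_dirac_lintegral_zero y K (fun y => meanCond K n 0 1 y)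
    ((measurable_meanCond K n).comp (f := fun y => ((0 : ℝ), (1 : ℝ), y)) (by fun_prop))] at h
  rw [h]
  exact lintegral_mono fun γ => ray_hit_le γ n

end MeanConductance

/-! ### Powers of kernels -/

section KernelPow

variable {E : Type*} [MeasurableSpace E]

lemma isMarkovKernel_pow (K : Kernel E E) [IsMarkovKernel K] (n : ℕ) : IsMarkovKernel (K ^ n) := by
  induction n with
  | zero => exact inferInstanceAs (IsMarkovKernel Kernel.id)
  | succ n ih => exact inferInstanceAs (IsMarkovKernel ((K ^ n) ∘ₖ K))

lemma lintegral_pow_zero (K : Kernel E E) (y : E) {f : E → ℝ≥0∞} (hf : Measurable f) :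
    ∫⁻ z, f z ∂((K ^ 0) y) = f y := by
  change ∫⁻ z, f z ∂(Kernel.id y) = f y
  rw [Kernel.id_apply, lintegral_dirac' _ hf]

lemma lintegral_pow_add (K : Kernel E E) (m n : ℕ) (y : E) {f : E → ℝ≥0∞} (hf : Measurable f) :
    ∫⁻ z, f z ∂((K ^ (m + n)) y) = ∫⁻ x, ∫⁻ z, f z ∂((K ^ n) x) ∂((K ^ m) y) := by
  rw [add_comm, Kernel.pow_add, Kernel.lintegral_comp _ _ _ hf]

lemma lintegral_pow_succ (K : Kernel E E) (m : ℕ) (y : E) {f : E → ℝ≥0∞} (hf : Measurable f) :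
    ∫⁻ z, f z ∂((K ^ (m + 1)) y) = ∫⁻ x, ∫⁻ z, f z ∂(K x) ∂((K ^ m) y) := by
  rw [lintegral_pow_add K m 1 y hf, pow_one]

lemma lintegral_pow_succ' (K : Kernel E E) (m : ℕ) (y : E) {f : E → ℝ≥0∞} (hf : Measurable f) :
    ∫⁻ z, f z ∂((K ^ (m + 1)) y) = ∫⁻ x, ∫⁻ z, f z ∂((K ^ m) x) ∂(K y) := by
  rw [add_comm, lintegral_pow_add K 1 m y hf, pow_one]

lemma kernel_pow_mono {K₁ K₂ : Kernel E E} (h : ∀ y, K₁ y ≤ K₂ y) (m : ℕ) (y : E) :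
    (K₁ ^ m) y ≤ (K₂ ^ m) y := by
  suffices H : ∀ (f : E → ℝ≥0∞), Measurable f → ∫⁻ z, f z ∂((K₁ ^ m) y) ≤ ∫⁻ z, f z ∂((K₂ ^ m) y) by
    refine Measure.le_iff.2 fun s hs => ?_
    rw [← lintegral_indicator_one hs, ← lintegral_indicator_one hs]
    exact H _ (measurable_one.indicator hs)
  intro f hf
  induction m generalizing y with
  | zero => rw [lintegral_pow_zero _ _ hf, lintegral_pow_zero _ _ hf]
  | succ m ih =>
    rw [lintegral_pow_succ' _ _ _ hf, lintegral_pow_succ' _ _ _ hf]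
    exact lintegral_mono' (h y) fun x => ih x

lemma le_lintegral_kernel_pow (K : Kernel E E) {q c : ℝ≥0∞} (hq : ∀ y, q ≤ K y Set.univ)
    (m : ℕ) {f : E → ℝ≥0∞} (hf : Measurable f) (hc : ∀ x, c ≤ f x) (y : E) :
    q ^ m * c ≤ ∫⁻ z, f z ∂((K ^ m) y) := by
  induction m generalizing y with
  | zero => rw [lintegral_pow_zero _ _ hf, pow_zero, one_mul]; exact hc y
  | succ m ih =>
    rw [lintegral_pow_succ' _ _ _ hf]
    calc q ^ (m + 1) * c = (q ^ m * c) * q := by ring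
      _ ≤ (q ^ m * c) * K y Set.univ := by gcongr; exact hq y
      _ = ∫⁻ x, q ^ m * c ∂(K y) := by rw [lintegral_const]
      _ ≤ _ := lintegral_mono fun x => ih x

/-- The mean number, under `m` steps of `K`, of times in `1, …, m` outside `s`. -/
noncomputable def exitMean (K : Kernel E E) (s : Set E) : ℕ → E → ℝ≥0∞
  | 0, _ => 0
  | m + 1, y => K y sᶜ + ∫⁻ x, exitMean K s m x ∂(K y)

lemma measurable_exitMean (K : Kernel E E) {s : Set E} (hs : MeasurableSet s) (m : ℕ) :
    Measurable (exitMean K s m) := by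
  induction m with
  | zero => exact measurable_const
  | succ m ih => exact (K.measurable_coe hs.compl).add ih.lintegral_kernel

/-- Union bound: the restricted kernel loses only the paths that leave `s`. Each of these
contributes at most 1, and their probability is at most the mean number of times spent outside `s`.
-/
lemma lintegral_pow_le_restrict_add (K : Kernel E E) [IsMarkovKernel K] {s : Set E}
    (hs : MeasurableSet s) (m : ℕ) {f : E → ℝ≥0∞} (hf : Measurable f) (hf1 : ∀ x, f x ≤ 1) (y : E) :
    ∫⁻ z, f z ∂((K ^ m) y) ≤ ∫⁻ z, f z ∂((K.restrict hs ^ m) y) + exitMean K s m y := by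
  induction m generalizing y with
  | zero => rw [lintegral_pow_zero _ _ hf, lintegral_pow_zero _ _ hf]; exact le_self_add
  | succ m ih =>
    have hK : ∀ x, ∫⁻ z, f z ∂((K.restrict hs ^ m) x) ≤ 1 := by
      intro x
      have := isMarkovKernel_pow K m
      calc _ ≤ ∫⁻ z, 1 ∂((K ^ m) x) :=
            lintegral_mono' (kernel_pow_mono (fun y => Measure.restrict_le_self) m x) hf1
        _ = 1 := by simp
    rw [lintegral_pow_succ' _ _ _ hf, lintegral_pow_succ' _ _ _ hf, exitMean]
    calc ∫⁻ x, ∫⁻ z, f z ∂((K ^ m) x) ∂(K y)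
        ≤ ∫⁻ x, (∫⁻ z, f z ∂((K.restrict hs ^ m) x) + exitMean K s m x) ∂(K y) :=
          lintegral_mono fun x => ih x
      _ = ∫⁻ x, ∫⁻ z, f z ∂((K.restrict hs ^ m) x) ∂(K y) + ∫⁻ x, exitMean K s m x ∂(K y) :=
          lintegral_add_left hf.lintegral_kernel _
      _ = (∫⁻ x in s, ∫⁻ z, f z ∂((K.restrict hs ^ m) x) ∂(K y) +
            ∫⁻ x in sᶜ, ∫⁻ z, f z ∂((K.restrict hs ^ m) x) ∂(K y)) +
            ∫⁻ x, exitMean K s m x ∂(K y) := by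
          rw [lintegral_add_compl _ hs]
      _ ≤ (∫⁻ x in s, ∫⁻ z, f z ∂((K.restrict hs ^ m) x) ∂(K y) + K y sᶜ) +
            ∫⁻ x, exitMean K s m x ∂(K y) := by
          gcongr
          calc _ ≤ ∫⁻ x in sᶜ, 1 ∂(K y) := lintegral_mono fun x => hK x
            _ = K y sᶜ := by simp
      _ = _ := by rw [Kernel.lintegral_restrict, add_assoc]

/-- After l initial steps, each of the following m times comes l steps after an earlier time, so the
uniform bound on `K ^ l` applies to it whatever the state at that earlier time. -/
lemma lintegral_pow_exitMean_le (K : Kernel E E) [IsMarkovKernel K] {s : Set E}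
    (hs : MeasurableSet s) (l : ℕ) {δ : ℝ≥0∞} (hδ : ∀ x, (K ^ l) x sᶜ ≤ δ) (m : ℕ) (y : E) :
    ∫⁻ z, exitMean K s m z ∂((K ^ l) y) ≤ m * δ := by
  have hind : Measurable (sᶜ.indicator (1 : E → ℝ≥0∞)) := measurable_one.indicator hs.compl
  induction m generalizing y with
  | zero => simp [exitMean]
  | succ m ih =>
    have hm := measurable_exitMean K hs m
    simp only [exitMean]
    rw [lintegral_add_left (K.measurable_coe hs.compl), Nat.cast_add, Nat.cast_one, add_mul,
      one_mul, add_comm]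
    refine add_le_add ?_ ?_
    · rw [← lintegral_pow_succ K l y hm, lintegral_pow_succ' K l y hm]
      calc _ ≤ ∫⁻ x, (m : ℝ≥0∞) * δ ∂(K y) := lintegral_mono fun x => ih x
        _ = _ := by simp
    · simp_rw [← lintegral_indicator_one hs.compl]
      rw [← lintegral_pow_succ K l y hind, lintegral_pow_succ' K l y hind]
      calc _ ≤ ∫⁻ x, δ ∂(K y) := lintegral_mono fun x => by
            rw [lintegral_indicator_one hs.compl]; exact hδ x
        _ = _ := by simp

end KernelPow


/-! ### The cost of prepending edges to a line of descent. -/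

section LowerBound

variable {S : Type*} [MeasurableSpace S]

/-- Enlarging every resistance by a factor of at most t divides 1/R by at most t. -/
lemma le_meanCond_of_scale (K : Kernel (State S) (State S)) {t : ℝ} (ht : 0 < t) (n : ℕ)
    {a c a' c' : ℝ} (ha' : 0 ≤ a') (hc' : 0 < c') (ha : a' ≤ t * a) (hc : c' ≤ t * c)
    (y : State S) :
    ENNReal.ofReal (1 / t) * meanCond K n a c y ≤ meanCond K n a' c' y := by
  induction n generalizing a c a' c' y with
  | zero =>
    rw [meanCond, meanCond, ← ENNReal.ofReal_mul (by positivity)]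
    refine ENNReal.ofReal_le_ofReal ?_
    rw [div_mul_div_comm, one_mul]
    exact one_div_le_one_div_of_le (by positivity) (by rw [mul_add]; exact add_le_add ha hc)
  | succ n ih =>
    rw [meanCond, meanCond]
    refine (lintegral_const_mul_le _ _).trans (lintegral_mono fun z => ?_)
    have hz := State.weight_pos z
    refine ih (by positivity) (by positivity) ?_ ?_ z
    · rw [mul_add]; exact add_le_add ha hc
    · rw [← mul_div_assoc]; gcongr

lemma meanCond_succ_le (K : Kernel (State S) (State S)) [IsMarkovKernel K] (n : ℕ) {a c : ℝ}
    (ha : 0 ≤ a) (hc : 0 < c) (y : State S) : meanCond K (n + 1) a c y ≤ meanCond K n a c y := by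
  induction n generalizing a c y with
  | zero =>
    simp only [meanCond]
    calc _ ≤ ∫⁻ z, ENNReal.ofReal (1 / (a + c)) ∂(K y) := by
          refine lintegral_mono fun z => ENNReal.ofReal_le_ofReal ?_
          have hz := State.weight_pos z
          exact one_div_le_one_div_of_le (by positivity) (le_add_of_nonneg_right (by positivity))
      _ = _ := by simp
  | succ n ih =>
    rw [meanCond, meanCond]
    refine lintegral_mono fun z => ?_
    have hz := State.weight_pos z
    exact ih (by positivity) (by positivity) z

lemma meanCond_antitone (K : Kernel (State S) (State S)) [IsMarkovKernel K] (y : State S) :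
    Antitone fun n => meanCond K n 0 1 y :=
  antitone_nat_of_succ_le fun n => meanCond_succ_le K n le_rfl one_pos y

/-- The states of weight greater than `ε`. -/
def heavy (S : Type*) (ε : ℝ) : Set (State S) := {z | ε < z.weight}

lemma measurableSet_heavy (ε : ℝ) : MeasurableSet (heavy S ε) :=
  measurableSet_lt measurable_const measurable_weight

lemma measurable_meanCond_root (K : Kernel (State S) (State S)) [IsMarkovKernel K] (n : ℕ) :
    Measurable (meanCond K n 0 1) :=
  (measurable_meanCond K n).comp (f := fun y => ((0 : ℝ), (1 : ℝ), y)) (by fun_prop)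

/-- If the first edge leads to a state of weight A > ε and R ≥ 1 is the resistance from there on,
with unit first edge, then the full resistance is 1 + R/A ≤ (1 + 1/ε) R. This costs one factor per
heavy step. -/
lemma le_meanCond_add (K : Kernel (State S) (State S)) [IsMarkovKernel K] {ε : ℝ} (hε : 0 < ε)
    (n j : ℕ) (y : State S) :
    ENNReal.ofReal (1 / (1 + 1 / ε)) ^ j *
      ∫⁻ z, meanCond K n 0 1 z ∂((K.restrict (measurableSet_heavy ε) ^ j) y) ≤
        meanCond K (n + j) 0 1 y := by
  set θ := ENNReal.ofReal (1 / (1 + 1 / ε))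
  have one : ∀ n y, θ * ∫⁻ z, meanCond K n 0 1 z ∂(K.restrict (measurableSet_heavy ε) y) ≤
      meanCond K (n + 1) 0 1 y := by
    intro n y
    rw [meanCond, Kernel.lintegral_restrict]
    refine le_trans ?_ (setLIntegral_le_lintegral (heavy S ε) _)
    refine (lintegral_const_mul_le _ _).trans
      (setLIntegral_mono' (measurableSet_heavy ε) fun z hz => ?_)
    have hz0 := State.weight_pos z
    have hz1 : 1 / z.weight ≤ 1 / ε := one_div_le_one_div_of_le hε (le_of_lt hz)
    -- For n > 0 a second unfolding is needed before scaling: as it stands the source has a = 0 and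
    -- cannot dominate the target a = 1, whereas one step later the unit edge has been moved into
    -- `a`.
    cases n with
    | zero =>
      rw [meanCond, meanCond, ← ENNReal.ofReal_mul (by positivity)]
      refine ENNReal.ofReal_le_ofReal ?_
      rw [zero_add, div_one, mul_one]
      exact one_div_le_one_div_of_le (by positivity) (by gcongr)
    | succ m =>
      rw [meanCond, meanCond]
      refine (lintegral_const_mul_le _ _).trans (lintegral_mono fun x => ?_)
      have hx0 := State.weight_pos x
      refine le_meanCond_of_scale K (by positivity) m (by positivity) (by positivity) ?_ ?_ x
      · rw [zero_add, mul_one]; gcongr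
      · rw [← mul_div_assoc, mul_one]
        gcongr
        linarith
  induction j generalizing y with
  | zero => rw [lintegral_pow_zero _ _ (measurable_meanCond_root K n), pow_zero, one_mul, add_zero]
  | succ j ih =>
    rw [lintegral_pow_succ' _ _ _ (measurable_meanCond_root K n)]
    calc _ = θ * (θ ^ j * ∫⁻ x, ∫⁻ z, meanCond K n 0 1 z
              ∂((K.restrict (measurableSet_heavy ε) ^ j) x)
              ∂(K.restrict (measurableSet_heavy ε) y)) := by ring
      _ ≤ θ * ∫⁻ x, meanCond K (n + j) 0 1 x ∂(K.restrict (measurableSet_heavy ε) y) := by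
          gcongr
          exact (lintegral_const_mul_le _ _).trans (lintegral_mono fun x => ih x)
      _ ≤ _ := one _ y

end LowerBound

/-! ### Lower bounds uniform in the starting state. -/

section UniformBound

variable {S : Type*} [MeasurableSpace S]

/-- A value of η below 1 forces the infimum inside it to be positive. The upper cut r is then
dropped, since only small weights create large resistances. -/
lemma Assumption2.exists_heavy {K : Kernel (State S) (State S)} (h : Assumption2 K) :
    ∃ ε : ℝ, 0 < ε ∧ ∃ q : ℝ≥0∞, q ≠ 0 ∧ ∀ y, q ≤ K y (heavy S ε) := by
  have h1 : ∃ᶠ q : ℝ × ℝ in 𝓝[>] 0 ×ˢ atTop, eta K q.1 q.2 < 1 := frequently_lt_of_liminf_lt (by isBoundedDefault) h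
  have h2 : ∀ᶠ q : ℝ × ℝ in 𝓝[>] (0 : ℝ) ×ˢ (atTop : Filter ℝ), 0 < q.1 :=
    (eventually_mem_nhdsWithin (a := (0 : ℝ)) (s := Set.Ioi 0)).prod_inl _
  obtain ⟨⟨ε, r⟩, h3, h4⟩ := (h1.and_eventually h2).exists
  refine ⟨ε, h4, ⨅ y : State S, K y {z | ε < z.weight ∧ z.weight ≤ r}, fun h0 => ?_, fun y => ?_⟩
  · simp only [eta] at h3
    rw [h0] at h3
    simp at h3
  · exact (iInf_le _ y).trans (measure_mono fun z hz => hz.1)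

lemma tendsto_heavy_compl (μ : Measure (State S)) [IsFiniteMeasure μ] :
    Tendsto (fun k : ℕ => μ (heavy S (1 / ((k : ℝ) + 1)))ᶜ) atTop (𝓝 0) := by
  have h := tendsto_measure_iInter_atTop (μ := μ)
    (s := fun k : ℕ => (heavy S (1 / ((k : ℝ) + 1)))ᶜ)
    (fun k => (measurableSet_heavy _).compl.nullMeasurableSet)
    (by
      intro i j hij
      refine Set.compl_subset_compl.2 fun z hz => ?_
      have : 1 / ((j : ℝ) + 1) ≤ 1 / ((i : ℝ) + 1) := by gcongr
      exact this.trans_lt hz)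
    ⟨0, measure_ne_top _ _⟩
  have h0 : ⋂ k : ℕ, (heavy S (1 / ((k : ℝ) + 1)))ᶜ = ∅ := by
    rw [← Set.compl_iUnion, Set.compl_empty_iff, Set.eq_univ_iff_forall]
    intro z
    obtain ⟨k, hk⟩ := exists_nat_one_div_lt (State.weight_pos z)
    exact Set.mem_iUnion.2 ⟨k, hk⟩
  rw [h0, measure_empty] at h
  exact h

/-- Under the two assumptions, a lower bound for `meanCond K n 0 1` on a set of positive
`K ^ ℓ`-probability spreads, up to a constant factor, to all states. -/
lemma exists_uniform_bound {K : Kernel (State S) (State S)} [IsMarkovKernel K] {ℓ N : ℕ} {κ : ℝ≥0}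
    (h1 : Assumption1 K ℓ N κ) (h2 : Assumption2 K) (x₀ : State S) {c₁ : ℝ≥0∞} (hc₁ : c₁ ≠ 0)
    (hc₁' : c₁ ≤ 1) :
    ∃ c : ℝ≥0∞, c ≠ 0 ∧ ∀ (n : ℕ) (r : ℝ≥0∞),
      c₁ ≤ (K ^ ℓ) x₀ {y | r ≤ meanCond K n 0 1 y} → ∀ y, c * r ≤ meanCond K n 0 1 y := by
  obtain ⟨ε₀, hε₀, q, hq0, hq⟩ := h2.exists_heavy
  have hq1 : q ≤ 1 := (hq x₀).trans prob_le_one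
  have hN : (N : ℝ≥0∞) ≠ 0 := by
    have := h1.pos.trans_le h1.le
    simp only [ne_eq, Nat.cast_eq_zero]; omega
  have hκN : (κ : ℝ≥0∞) / N ≠ ⊤ := ENNReal.div_ne_top ENNReal.coe_ne_top hN
  have hκ0 : (κ : ℝ≥0∞) / N ≠ 0 := ENNReal.div_ne_zero.2
    ⟨by have := h1.one_le; simp only [ne_eq, ENNReal.coe_eq_zero]; rintro rfl; simp at this, by simp⟩
  -- The available mass: ℓ steps into states heavier than `ε₀`, each of probability at least `q`,
  -- then the mass `c₁` that Assumption 1 compares with the laws of the next N steps.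
  set u := q ^ ℓ * c₁ with hu
  have hu0 : u ≠ 0 := mul_ne_zero (pow_ne_zero _ hq0) hc₁
  have hu1 : u ≠ ⊤ := ne_top_of_le_ne_top ENNReal.one_ne_top
    (mul_le_one' (pow_le_one' hq1 ℓ) hc₁')
  -- By Assumption 1 this bounds the `K ^ ℓ`-probability of light states from all starting points at
  -- once, and it tends to 0. A single step need not have such uniform smallness, which is why ℓ
  -- steps above the fixed level `ε₀` come first.
  let δ : ℕ → ℝ≥0∞ := fun k => (κ : ℝ≥0∞) / N * ∑ m ∈ Finset.Icc 1 N,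
    (K ^ m) x₀ (heavy S (1 / ((k : ℝ) + 1)))ᶜ
  have hδ : Tendsto (fun k => (κ : ℝ≥0∞) / N * (N * (N * δ k))) atTop (𝓝 0) := by
    have e : Tendsto δ atTop (𝓝 ((κ : ℝ≥0∞) / N * ∑ m ∈ Finset.Icc 1 N, 0)) := by
      refine ENNReal.Tendsto.const_mul (tendsto_finsetSum _ fun m _ => ?_) (Or.inr hκN)
      have := isMarkovKernel_pow K m
      exact tendsto_heavy_compl _
    rw [Finset.sum_const_zero, mul_zero] at e
    have := ENNReal.Tendsto.const_mul (a := (κ : ℝ≥0∞) / N) (ENNReal.Tendsto.const_mul (a := (N : ℝ≥0∞))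
      (ENNReal.Tendsto.const_mul (a := (N : ℝ≥0∞)) e (Or.inr (by simp))) (Or.inr (by simp)))
      (Or.inr hκN)
    simpa using this
  have hu2 : 0 < u / 2 := ENNReal.half_pos hu0
  -- The level ε is so small that the total loss, N terms of at most N δ each with weight κ/N, uses
  -- up at most half of `u`, and that states heavier than `ε₀` are heavier than ε.
  obtain ⟨k, hk1, hk2⟩ := ((hδ.eventually (Iic_mem_nhds hu2)).and
    ((tendsto_one_div_add_atTop_nhds_zero_nat (𝕜 := ℝ)).eventually (Iic_mem_nhds hε₀))).exists
  set ε : ℝ := 1 / ((k : ℝ) + 1)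
  have hε : 0 < ε := by positivity
  have hk2 : ε ≤ ε₀ := hk2
  have hk1 : (κ : ℝ≥0∞) / N * (N * (N * δ k)) ≤ u / 2 := hk1
  have hbad : ∀ x, (K ^ ℓ) x (heavy S ε)ᶜ ≤ δ k := fun x =>
    h1.bound x x₀ _ (measurableSet_heavy ε).compl
  set θ := ENNReal.ofReal (1 / (1 + 1 / ε)) with hθ
  have hθ0 : θ ≠ 0 := by
    rw [hθ, ne_eq, ENNReal.ofReal_eq_zero, not_le]; positivity
  have hθ1 : θ ≤ 1 := by
    rw [hθ, ENNReal.ofReal_le_one]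
    rw [div_le_one (by positivity)]
    have : 0 < 1 / ε := by positivity
    linarith
  refine ⟨θ ^ (ℓ + N) * (u / 2) / ((κ : ℝ≥0∞) / N * N), ?_, fun n r hr y => ?_⟩
  · exact ENNReal.div_ne_zero.2 ⟨mul_ne_zero (pow_ne_zero _ hθ0) hu2.ne',
      ENNReal.mul_ne_top hκN (by simp)⟩
  set G : Set (State S) := {y | r ≤ meanCond K n 0 1 y}
  have hG : MeasurableSet G := measurableSet_le measurable_const (measurable_meanCond_root K n)
  set f : State S → ℝ≥0∞ := G.indicator 1
  have hf : Measurable f := measurable_one.indicator hG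
  have hf1 : ∀ x, f x ≤ 1 := fun x => Set.indicator_le_self' (by simp) x
  set L := K.restrict (measurableSet_heavy (S := S) ε)
  set L₀ := K.restrict (measurableSet_heavy (S := S) ε₀)
  have hL₀ : ∀ y, L₀ y ≤ L y := fun y => Measure.restrict_mono_set _ fun z hz => hk2.trans_lt hz
  have hL₀' : ∀ y, L₀ y ≤ K y := fun y => Measure.restrict_le_self
  have hmass : ∀ y, q ≤ L₀ y Set.univ := fun y => by
    rw [Kernel.restrict_apply, Measure.restrict_apply_univ]; exact hq y
  have hterm : ∀ m ∈ Finset.Icc 1 N, ∫⁻ x, (K ^ m) x G ∂((L₀ ^ ℓ) y) ≤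
      ∫⁻ z, f z ∂((L ^ (ℓ + m)) y) + N * δ k := by
    intro m hm
    calc ∫⁻ x, (K ^ m) x G ∂((L₀ ^ ℓ) y) = ∫⁻ x, ∫⁻ z, f z ∂((K ^ m) x) ∂((L₀ ^ ℓ) y) := by
          simp_rw [f, lintegral_indicator_one hG]
      _ ≤ ∫⁻ x, (∫⁻ z, f z ∂((L ^ m) x) + exitMean K (heavy S ε) m x) ∂((L₀ ^ ℓ) y) :=
          lintegral_mono fun x => lintegral_pow_le_restrict_add K (measurableSet_heavy ε) m hf hf1 x
      _ = ∫⁻ x, ∫⁻ z, f z ∂((L ^ m) x) ∂((L₀ ^ ℓ) y) +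
            ∫⁻ x, exitMean K (heavy S ε) m x ∂((L₀ ^ ℓ) y) :=
          lintegral_add_left hf.lintegral_kernel _
      _ ≤ ∫⁻ x, ∫⁻ z, f z ∂((L ^ m) x) ∂((L ^ ℓ) y) +
            ∫⁻ x, exitMean K (heavy S ε) m x ∂((K ^ ℓ) y) :=
          add_le_add (lintegral_mono' (kernel_pow_mono hL₀ ℓ y) le_rfl)
            (lintegral_mono' (kernel_pow_mono hL₀' ℓ y) le_rfl)
      _ ≤ _ := by
          rw [← lintegral_pow_add L ℓ m y hf]
          gcongr
          refine (lintegral_pow_exitMean_le K (measurableSet_heavy ε) ℓ hbad m y).trans ?_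
          gcongr
          exact (Finset.mem_Icc.1 hm).2
  have hsum : u ≤ (κ : ℝ≥0∞) / N * ∑ m ∈ Finset.Icc 1 N, ∫⁻ z, f z ∂((L ^ (ℓ + m)) y) + u / 2 := by
    calc u ≤ ∫⁻ x, (κ : ℝ≥0∞) / N * ∑ m ∈ Finset.Icc 1 N, (K ^ m) x G ∂((L₀ ^ ℓ) y) := by
          refine le_lintegral_kernel_pow L₀ hmass ℓ ?_ (fun x => ?_) y
          · exact (Finset.measurable_sum _ fun m _ => (K ^ m).measurable_coe hG).const_mul _
          · exact hr.trans (h1.bound x₀ x G hG)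
      _ = (κ : ℝ≥0∞) / N * ∑ m ∈ Finset.Icc 1 N, ∫⁻ x, (K ^ m) x G ∂((L₀ ^ ℓ) y) := by
          rw [lintegral_const_mul _ (Finset.measurable_sum _ fun m _ => (K ^ m).measurable_coe hG),
            lintegral_finsetSum _ fun m _ => (K ^ m).measurable_coe hG]
      _ ≤ (κ : ℝ≥0∞) / N * ∑ m ∈ Finset.Icc 1 N, (∫⁻ z, f z ∂((L ^ (ℓ + m)) y) + N * δ k) := by
          gcongr with m hm
          exact hterm m hm
      _ = (κ : ℝ≥0∞) / N * ∑ m ∈ Finset.Icc 1 N, ∫⁻ z, f z ∂((L ^ (ℓ + m)) y) +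
            (κ : ℝ≥0∞) / N * (N * (N * δ k)) := by
          rw [Finset.sum_add_distrib, mul_add, Finset.sum_const, Nat.card_Icc, nsmul_eq_mul]
          simp
      _ ≤ _ := by gcongr
  have hhalf : u / 2 ≤ (κ : ℝ≥0∞) / N * ∑ m ∈ Finset.Icc 1 N, ∫⁻ z, f z ∂((L ^ (ℓ + m)) y) := by
    nth_rw 1 [← ENNReal.add_halves u] at hsum
    exact (ENNReal.add_le_add_iff_right (ENNReal.div_ne_top hu1 (by simp))).1 hsum
  have hH : ∀ m ∈ Finset.Icc 1 N, θ ^ (ℓ + N) * r * ∫⁻ z, f z ∂((L ^ (ℓ + m)) y) ≤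
      meanCond K n 0 1 y := by
    intro m hm
    calc θ ^ (ℓ + N) * r * ∫⁻ z, f z ∂((L ^ (ℓ + m)) y)
        = θ ^ (ℓ + N) * ∫⁻ z, r * f z ∂((L ^ (ℓ + m)) y) := by
          rw [lintegral_const_mul _ hf, mul_assoc]
      _ ≤ θ ^ (ℓ + m) * ∫⁻ z, meanCond K n 0 1 z ∂((L ^ (ℓ + m)) y) := by
          refine mul_le_mul' (pow_le_pow_right_of_le_one' hθ1 ?_) (lintegral_mono fun z => ?_)
          · have := (Finset.mem_Icc.1 hm).2; omega
          · by_cases hz : z ∈ G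
            · simp only [f, Set.indicator_of_mem hz, Pi.one_apply, mul_one]
              exact hz
            · simp [f, hz]
      _ ≤ meanCond K (n + (ℓ + m)) 0 1 y := le_meanCond_add K hε n (ℓ + m) y
      -- The lengthened line has n + ℓ + m further edges; keeping only n of them can only raise the
      -- mean conductance.
      _ ≤ _ := meanCond_antitone K y (by omega)
  rw [← ENNReal.mul_div_right_comm]
  refine ENNReal.div_le_of_le_mul' ?_
  calc θ ^ (ℓ + N) * (u / 2) * r = θ ^ (ℓ + N) * r * (u / 2) := by ring
    _ ≤ θ ^ (ℓ + N) * r *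
        ((κ : ℝ≥0∞) / N * ∑ m ∈ Finset.Icc 1 N, ∫⁻ z, f z ∂((L ^ (ℓ + m)) y)) := by gcongr
    _ = (κ : ℝ≥0∞) / N *
        ∑ m ∈ Finset.Icc 1 N, θ ^ (ℓ + N) * r * ∫⁻ z, f z ∂((L ^ (ℓ + m)) y) := by
        rw [← Finset.mul_sum]; ring
    _ ≤ (κ : ℝ≥0∞) / N * ∑ m ∈ Finset.Icc 1 N, meanCond K n 0 1 y := by
        gcongr with m hm
        exact hH m hm
    _ = (κ : ℝ≥0∞) / N * N * meanCond K n 0 1 y := by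
        rw [Finset.sum_const, Nat.card_Icc, nsmul_eq_mul]
        simp [mul_assoc]

/-- Exponential lower bound for `meanCond K n 0 1`, uniform in the state. -/
lemma exists_exp_lower_bound {K : Kernel (State S) (State S)} [IsMarkovKernel K] {ℓ N : ℕ} {κ : ℝ≥0}
    (h1 : Assumption1 K ℓ N κ) (h2 : Assumption2 K) (x₀ : State S) {b : ℝ}
    (hlim : ((-Real.log b : ℝ) : EReal) <
      liminf (fun n : ℕ => (((1 : ℝ) / n : ℝ) : EReal) * meanLogHit K n ((K ^ ℓ) x₀)) atTop) :
    ∃ t : ℝ, t < Real.log b ∧ ∃ c : ℝ≥0∞, c ≠ 0 ∧ ∀ᶠ n : ℕ in atTop, ∀ y,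
      c * ENNReal.ofReal (Real.exp (-t * n)) ≤ meanCond K n 0 1 y := by
  obtain ⟨α, hα1, hα2⟩ := EReal.lt_iff_exists_real_btwn.1 hlim
  have hα1 : -Real.log b < α := EReal.coe_lt_coe_iff.1 hα1
  set β := (K ^ ℓ) x₀
  have := isMarkovKernel_pow K ℓ
  have hprob : IsProbabilityMeasure β := inferInstance
  have hev := eventually_lt_of_lt_liminf hα2
  have hI : ∀ᶠ n : ℕ in atTop, 1 ≤ n ∧ α < 0 ∧
      ∫⁻ y, (-ENNReal.log (hitProb K n y)).toENNReal ∂β ≤ ENNReal.ofReal (-α * n) := by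
    filter_upwards [hev, eventually_ge_atTop 1] with n hn hn1
    have hn0 : (0 : ℝ) < n := by exact_mod_cast hn1
    unfold meanLogHit at hn
    set I := ∫⁻ y, (-ENNReal.log (hitProb K n y)).toENNReal ∂β
    have hItop : I ≠ ⊤ := by
      intro h
      rw [h] at hn
      have : ((1 / (n : ℝ) : ℝ) : EReal) * (-((⊤ : ℝ≥0∞) : EReal)) = ⊥ := by
        rw [EReal.coe_ennreal_top, EReal.neg_top, EReal.coe_mul_bot_of_pos (by positivity)]
      rw [this] at hn
      exact not_lt_bot hn
    have hIr : (I : EReal) = ((I.toReal : ℝ) : EReal) := (EReal.coe_ennreal_toReal hItop).symm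
    rw [hIr, ← EReal.coe_neg, ← EReal.coe_mul, EReal.coe_lt_coe_iff] at hn
    have hI0 : 0 ≤ I.toReal := ENNReal.toReal_nonneg
    have h3 : I.toReal < -α * n := by
      rw [one_div, inv_mul_eq_div, lt_div_iff₀ hn0] at hn
      linarith
    refine ⟨hn1, by nlinarith, ?_⟩
    rw [← ENNReal.ofReal_toReal hItop]
    exact ENNReal.ofReal_le_ofReal h3.le
  -- Negativity of α, read off from 0 ≤ I < -α n for a single n, makes t positive. The gap between
  -- -α and log b leaves room for t, and Markov's inequality at level t n then excludes a β-mass of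
  -- at most -α/t < 1.
  obtain ⟨_, _, hα0, _⟩ := hI.exists
  obtain ⟨t, ht1, ht2⟩ := exists_between (show -α < Real.log b by linarith)
  have ht0 : 0 < t := by linarith
  have hst : ENNReal.ofReal (-α / t) < 1 := by
    rw [ENNReal.ofReal_lt_one, div_lt_one ht0]; exact ht1
  obtain ⟨c, hc0, hc⟩ := exists_uniform_bound h1 h2 x₀ (c₁ := 1 - ENNReal.ofReal (-α / t))
    (by rw [ne_eq, tsub_eq_zero_iff_le, not_le]; exact hst) tsub_le_self
  refine ⟨t, ht2, c, hc0, ?_⟩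
  filter_upwards [hI] with n hn y
  obtain ⟨hn1, -, hn⟩ := hn
  have hn0 : (0 : ℝ) < n := by exact_mod_cast hn1
  refine hc n _ ?_ y
  -- Defined through `meanCond` rather than `hitProb`, because measurability of `meanCond` is at
  -- hand; the upper bound on `hitProb` transfers the estimate.
  set G : Set (State S) := {y | ENNReal.ofReal (Real.exp (-t * n)) ≤ meanCond K n 0 1 y}
  have hG : MeasurableSet G := measurableSet_le measurable_const (measurable_meanCond_root K n)
  have hGc : β Gᶜ ≤ ENNReal.ofReal (-α / t) := by
    have h3 : ENNReal.ofReal (t * n) * β Gᶜ ≤ ENNReal.ofReal (-α * n) := by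
      refine le_trans ?_ hn
      rw [← setLIntegral_const]
      refine (setLIntegral_mono' hG.compl fun y hy => ?_).trans (setLIntegral_le_lintegral _ _)
      have hy' : meanCond K n 0 1 y < ENNReal.ofReal (Real.exp (-t * n)) := not_le.1 hy
      have h4 : ENNReal.log (hitProb K n y) ≤ ((-t * n : ℝ) : EReal) := by
        have := ENNReal.log_monotone ((hitProb_le_meanCond K n y).trans hy'.le)
        rwa [ENNReal.log_ofReal_of_pos (Real.exp_pos _), Real.log_exp] at this
      have h5 : ((t * n : ℝ) : EReal) ≤ -ENNReal.log (hitProb K n y) := by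
        rw [EReal.le_neg, ← EReal.coe_neg, ← neg_mul]; exact h4
      calc ENNReal.ofReal (t * n) = ((t * n : ℝ) : EReal).toENNReal := by
            rw [EReal.toENNReal_of_ne_top (EReal.coe_ne_top _), EReal.toReal_coe]
        _ ≤ _ := EReal.toENNReal_le_toENNReal h5
    have htn : 0 < t * n := by positivity
    have : -α / t = (-α * n) / (t * n) := by field_simp
    rw [this, ENNReal.ofReal_div_of_pos htn]
    rw [ENNReal.le_div_iff_mul_le (Or.inl (by simpa using htn)) (Or.inl (by simp)), mul_comm]
    exact h3
  rw [prob_compl_eq_one_sub hG, tsub_le_iff_left] at hGc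
  rw [tsub_le_iff_left]
  exact hGc.trans_eq (add_comm _ _)

end UniformBound

/-! ### The branching property -/

section Branching

variable {E : Type*} [MeasurableSpace E]

lemma lintegral_generationKernel_prod (L : Kernel E (ℕ → E)) [IsMarkovKernel L] (n : ℕ)
    (h : (i : Finset.Iic n) → Level i → E) (s : Finset (Level n))
    (ψ : Level n → (ℕ → E) → ℝ≥0∞) (hψ : ∀ ν, Measurable (ψ ν)) :
    ∫⁻ z, ∏ ν ∈ s, ψ ν (fun i => z ⟨i :: ν.1, by simp [ν.2]⟩) ∂(generationKernel L n h) =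
      ∏ ν ∈ s, ∫⁻ f, ψ ν f ∂(L (h ⟨n, Finset.mem_Iic.2 le_rfl⟩ ν)) := by
  have hm : Measurable fun z : Level (n + 1) → E =>
      ∏ ν ∈ s, ψ ν (fun i => z ⟨i :: ν.1, by simp [ν.2]⟩) :=
    Finset.measurable_prod _ fun ν _ => (hψ ν).comp (measurable_pi_iff.2 fun i => measurable_pi_apply _)
  have e : generationKernel L n h =
      (Measure.infinitePi fun ν => L (h ⟨n, Finset.mem_Iic.2 le_rfl⟩ ν)).map (relabel n) := by
    unfold generationKernel
    rw [Kernel.comap_apply, Kernel.map_apply _ (measurable_relabel n)]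
    rfl
  rw [e, lintegral_map hm (measurable_relabel n)]
  have e2 : ∀ f : Level n → ℕ → E, ∏ ν ∈ s, ψ ν (fun i => relabel n f ⟨i :: ν.1, by simp [ν.2]⟩) =
      ∏ ν ∈ s, ψ ν (f ν) := fun f => rfl
  simp only [e2]
  rw [lintegral_prod_eq_prod_lintegral_of_indepFun s (fun ν (f : Level n → ℕ → E) => ψ ν (f ν))
    (iIndepFun_infinitePi hψ) (fun ν => (hψ ν).comp (measurable_pi_apply ν))]
  refine Finset.prod_congr rfl fun ν _ => ?_
  rw [← lintegral_map (f := ψ ν) (hψ ν) (measurable_pi_apply ν), Measure.infinitePi_map_eval]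

/-- Evaluation of a sequence of generations at a word. -/
def wordEval (G : (n : ℕ) → Level n → E) (ν : List ℕ) : E := G ν.length ⟨ν, rfl⟩

lemma measurable_wordEval : Measurable (wordEval (E := E)) :=
  measurable_pi_iff.2 fun ν => (measurable_pi_apply (⟨ν, rfl⟩ : Level ν.length)).comp
    (measurable_pi_apply (X := fun n => Level n → E) ν.length)

omit [MeasurableSpace E] in
lemma wordEval_apply (G : (n : ℕ) → Level n → E) {n : ℕ} (ν : Level n) :
    wordEval G ν.1 = G n ν := by
  obtain ⟨ν, rfl⟩ := ν
  rfl

lemma isProbabilityMeasure_map_const (ι : Type*) (μ₀ : Measure E) [IsProbabilityMeasure μ₀] :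
    IsProbabilityMeasure (μ₀.map (fun (x : E) (_ : ι) => x)) :=
  Measure.isProbabilityMeasure_map (measurable_pi_iff.2 fun _ => measurable_id).aemeasurable

/-- Given the generations up to `n`, the families of the vertices of generation `n` are independent
with laws given by `L`. -/
lemma branchingLaw_lintegral_succ (μ₀ : Measure E) [IsProbabilityMeasure μ₀]
    (L : Kernel E (ℕ → E)) [IsMarkovKernel L] (n : ℕ) (Φ : (List ℕ → E) → ℝ≥0∞)
    (hΦ : Measurable Φ) (hdep : ∀ T T', (∀ ν : List ℕ, ν.length ≤ n → T ν = T' ν) → Φ T = Φ T')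
    (s : Finset (List ℕ)) (hs : ∀ ν ∈ s, ν.length = n)
    (ψ : List ℕ → (ℕ → E) → ℝ≥0∞) (hψ : ∀ ν, Measurable (ψ ν)) :
    ∫⁻ T, Φ T * ∏ ν ∈ s, ψ ν (fun i => T (i :: ν)) ∂(branchingLaw μ₀ L) =
      ∫⁻ T, Φ T * ∏ ν ∈ s, ∫⁻ f, ψ ν f ∂(L (T ν)) ∂(branchingLaw μ₀ L) := by
  have := isProbabilityMeasure_map_const (Level 0) μ₀
  obtain ⟨s', rfl⟩ : ∃ s' : Finset (Level n), s = s'.map (Function.Embedding.subtype _) := by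
    refine ⟨s.subtype _, ?_⟩
    rw [Finset.subtype_map_of_mem hs]
  have hm1 : Measurable fun T : List ℕ → E =>
      Φ T * ∏ ν ∈ s'.map (Function.Embedding.subtype _), ψ ν (fun i => T (i :: ν)) :=
    hΦ.mul (Finset.measurable_prod _ fun ν _ => (hψ ν).comp
      (measurable_pi_iff.2 fun i => measurable_pi_apply _))
  have hm2 : Measurable fun T : List ℕ → E =>
      Φ T * ∏ ν ∈ s'.map (Function.Embedding.subtype _), ∫⁻ f, ψ ν f ∂(L (T ν)) :=
    hΦ.mul (Finset.measurable_prod _ fun ν _ => (hψ ν).lintegral_kernel.comp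
      (measurable_pi_apply ν))
  unfold branchingLaw
  change ∫⁻ T, _ ∂(Measure.map wordEval _) = ∫⁻ T, _ ∂(Measure.map wordEval _)
  rw [lintegral_map hm1 measurable_wordEval, lintegral_map hm2 measurable_wordEval]
  let ex : ((i : Finset.Iic n) → Level i → E) → List ℕ → E := fun h ν =>
    if hν : ν.length ≤ n then h ⟨ν.length, Finset.mem_Iic.2 hν⟩ ⟨ν, rfl⟩
    else h ⟨0, Finset.mem_Iic.2 (Nat.zero_le n)⟩ ⟨[], rfl⟩
  have hex : Measurable ex := by
    refine measurable_pi_iff.2 fun ν => ?_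
    by_cases hν : ν.length ≤ n
    · simp only [ex, hν, dif_pos]
      exact (measurable_pi_apply (⟨ν, rfl⟩ : Level ν.length)).comp
        (measurable_pi_apply (X := fun i : Finset.Iic n => Level i → E) _)
    · simp only [ex, hν, dif_neg, not_false_eq_true]
      exact (measurable_pi_apply (⟨[], rfl⟩ : Level 0)).comp
        (measurable_pi_apply (X := fun i : Finset.Iic n => Level i → E)
          ⟨0, Finset.mem_Iic.2 (Nat.zero_le n)⟩)
  have hΦex : ∀ G : (n : ℕ) → Level n → E, Φ (ex (Preorder.frestrictLe n G)) = Φ (wordEval G) := by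
    intro G
    refine hdep _ _ fun ν hν => ?_
    simp only [ex, hν, dif_pos]
    rfl
  let F : ((i : Finset.Iic n) → Level i → E) × (Level (n + 1) → E) → ℝ≥0∞ := fun q =>
    Φ (ex q.1) * ∏ ν ∈ s', ψ ν.1 (fun i => q.2 ⟨i :: ν.1, by simp [ν.2]⟩)
  have hF : Measurable F := (hΦ.comp (hex.comp measurable_fst)).mul
    (Finset.measurable_prod _ fun ν _ => (hψ ν.1).comp
      (measurable_pi_iff.2 fun i => (measurable_pi_apply _).comp measurable_snd))
  have key := lintegral_trajMeasure_succ (X := fun n => Level n → E)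
    (μ₀.map (fun (x : E) (_ : Level 0) => x)) (generationKernel L) n F hF
  have e1 : ∀ G : (n : ℕ) → Level n → E, Φ (wordEval G) *
      ∏ ν ∈ s'.map (Function.Embedding.subtype _), ψ ν (fun i => wordEval G (i :: ν)) =
        F (Preorder.frestrictLe n G, G (n + 1)) := by
    intro G
    simp only [F, hΦex, Finset.prod_map]
    congr 1
    refine Finset.prod_congr rfl fun ν _ => ?_
    congr 1
    funext i
    exact wordEval_apply G (⟨i :: ν.1, by simp [ν.2]⟩ : Level (n + 1))
  simp only [e1]
  rw [key]
  refine lintegral_congr fun G => ?_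
  simp only [F, hΦex, Finset.prod_map]
  rw [lintegral_const_mul, lintegral_generationKernel_prod L n _ s' (fun ν => ψ ν.1) fun ν => hψ ν.1]
  · congr 1
    refine Finset.prod_congr rfl fun ν _ => ?_
    have : wordEval G (Function.Embedding.subtype _ ν) = G n ν := wordEval_apply G ν
    rw [this]
    rfl
  · exact Finset.measurable_prod _ fun ν _ => (hψ ν.1).comp
      (measurable_pi_iff.2 fun i => measurable_pi_apply _)

lemma branchingLaw_lintegral_root (μ₀ : Measure E) [IsProbabilityMeasure μ₀]
    (L : Kernel E (ℕ → E)) [IsMarkovKernel L] (f : E → ℝ≥0∞) (hf : Measurable f) :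
    ∫⁻ T, f (T []) ∂(branchingLaw μ₀ L) = ∫⁻ x, f x ∂μ₀ := by
  unfold branchingLaw
  change ∫⁻ T, _ ∂(Measure.map wordEval _) = _
  have h0 : Measurable fun (x : E) (_ : Level 0) => x := measurable_pi_iff.2 fun _ => measurable_id
  have h1 : Measurable fun g : Level 0 → E => f (g ⟨[], rfl⟩) :=
    hf.comp (measurable_pi_apply _)
  rw [lintegral_map (f := fun T : List ℕ → E => f (T [])) (hf.comp (measurable_pi_apply []))
    measurable_wordEval]
  change ∫⁻ G : (n : ℕ) → Level n → E, (fun g : Level 0 → E => f (g ⟨[], rfl⟩)) (G 0) ∂_ = _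
  rw [← lintegral_map (f := fun g : Level 0 → E => f (g ⟨[], rfl⟩)) h1
    (measurable_pi_apply (X := fun n => Level n → E) 0), trajMeasure_map_frestrictLe_zero,
    lintegral_map h1 h0]

/-- The words of length `n` with letters smaller than `M`. -/
def levelBox (M : ℕ) : ℕ → Finset (List ℕ)
  | 0 => {[]}
  | n + 1 => (Finset.range M ×ˢ levelBox M n).image fun q => q.2 ++ [q.1]

lemma length_of_mem_levelBox {M n : ℕ} {ν : List ℕ} (h : ν ∈ levelBox M n) : ν.length = n := by
  induction n generalizing ν with
  | zero => simpa [levelBox] using h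
  | succ n ih =>
    simp only [levelBox, Finset.mem_image, Finset.mem_product] at h
    obtain ⟨⟨j, μ⟩, ⟨_, h2⟩, rfl⟩ := h
    simp [ih h2]

lemma prod_levelBox_succ (M n : ℕ) (g : List ℕ → ℝ≥0∞) :
    ∏ ν ∈ levelBox M (n + 1), g ν = ∏ j ∈ Finset.range M, ∏ ν ∈ levelBox M n, g (ν ++ [j]) := by
  rw [levelBox, Finset.prod_image, Finset.prod_product]
  rintro ⟨j, μ⟩ _ ⟨j', μ'⟩ _ h
  obtain ⟨h1, h2⟩ := List.append_inj' h rfl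
  simp_all

/-- The subtree at the `i`-th child of the root. -/
def child (i : ℕ) (T : List ℕ → E) : List ℕ → E := fun ν => T (ν ++ [i])

lemma measurable_child (i : ℕ) : Measurable (child (E := E) i) :=
  measurable_pi_iff.2 fun _ => measurable_pi_apply _

/-- The product of `φ ν (T ν)` over the words `ν` of length at most `n` with letters smaller
than `M`. -/
noncomputable def boxProd (M : ℕ) : ℕ → (List ℕ → E → ℝ≥0∞) → (List ℕ → E) → ℝ≥0∞
  | 0, φ, T => φ [] (T [])
  | n + 1, φ, T =>
    φ [] (T []) * ∏ i ∈ Finset.range M, boxProd M n (fun ν => φ (ν ++ [i])) (child i T)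

omit [MeasurableSpace E] in
-- `boxProd` splits the tree at the root, whereas the law of the field is built generation by
-- generation. This identity reconciles the two by peeling off the last generation.
lemma boxProd_succ (M n : ℕ) (φ : List ℕ → E → ℝ≥0∞) (T : List ℕ → E) :
    boxProd M (n + 1) φ T = boxProd M n φ T *
      ∏ ν ∈ levelBox M n, ∏ i ∈ Finset.range M, φ (i :: ν) (T (i :: ν)) := by
  induction n generalizing φ T with
  | zero => simp [boxProd, levelBox, child]
  | succ n ih =>
    rw [boxProd, boxProd]
    simp only [ih, Finset.prod_mul_distrib]
    rw [prod_levelBox_succ, mul_assoc]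
    rfl

/-- Multiplication of the factors of the words of length `n` by those of `g`. -/
noncomputable def mulLevel (n : ℕ) (φ g : List ℕ → E → ℝ≥0∞) (ν : List ℕ) (x : E) : ℝ≥0∞ :=
  if ν.length = n then φ ν x * g ν x else φ ν x

omit [MeasurableSpace E] in
lemma mulLevel_append (n : ℕ) (φ g : List ℕ → E → ℝ≥0∞) (i : ℕ) :
    (fun ν => mulLevel (n + 1) φ g (ν ++ [i])) =
      mulLevel n (fun ν => φ (ν ++ [i])) (fun ν => g (ν ++ [i])) := by
  funext ν x
  simp [mulLevel]

omit [MeasurableSpace E] in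
lemma boxProd_mulLevel (M n : ℕ) (φ g : List ℕ → E → ℝ≥0∞) (T : List ℕ → E) :
    boxProd M n (mulLevel n φ g) T = boxProd M n φ T * ∏ ν ∈ levelBox M n, g ν (T ν) := by
  induction n generalizing φ g T with
  | zero => simp [boxProd, levelBox, mulLevel]
  | succ n ih =>
    rw [boxProd, boxProd, prod_levelBox_succ]
    simp only [mulLevel_append, ih, Finset.prod_mul_distrib]
    have : mulLevel (n + 1) φ g [] (T []) = φ [] (T []) := by simp [mulLevel]
    rw [this, mul_assoc]
    rfl

lemma measurable_boxProd (M n : ℕ) (φ : List ℕ → E → ℝ≥0∞) (hφ : ∀ ν, Measurable (φ ν)) :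
    Measurable (boxProd M n φ) := by
  induction n generalizing φ with
  | zero => exact (hφ []).comp (measurable_pi_apply [])
  | succ n ih =>
    exact ((hφ []).comp (measurable_pi_apply [])).mul (Finset.measurable_prod _ fun i _ =>
      (ih _ fun ν => hφ _).comp (measurable_child i))

omit [MeasurableSpace E] in
lemma boxProd_congr (M n : ℕ) (φ : List ℕ → E → ℝ≥0∞) (T T' : List ℕ → E)
    (h : ∀ ν : List ℕ, ν.length ≤ n → T ν = T' ν) : boxProd M n φ T = boxProd M n φ T' := by
  induction n generalizing φ T T' with
  | zero => simp [boxProd, h []]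
  | succ n ih =>
    rw [boxProd, boxProd, h [] (by simp)]
    congr 1
    refine Finset.prod_congr rfl fun i _ => ih _ _ _ fun ν hν => h _ ?_
    simpa using hν

/-- The expectation of `boxProd` under the branching field with root value `x`. -/
noncomputable def boxMean (L : Kernel E (ℕ → E)) (M : ℕ) :
    ℕ → (List ℕ → E → ℝ≥0∞) → E → ℝ≥0∞
  | 0, φ, x => φ [] x
  | n + 1, φ, x =>
    φ [] x * ∫⁻ f, ∏ i ∈ Finset.range M, boxMean L M n (fun ν => φ (ν ++ [i])) (f i) ∂(L x)

lemma measurable_boxMean (L : Kernel E (ℕ → E)) [IsMarkovKernel L] (M n : ℕ)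
    (φ : List ℕ → E → ℝ≥0∞) (hφ : ∀ ν, Measurable (φ ν)) : Measurable (boxMean L M n φ) := by
  induction n generalizing φ with
  | zero => exact hφ []
  | succ n ih =>
    refine (hφ []).mul (Measurable.lintegral_kernel ?_)
    exact Finset.measurable_prod _ fun i _ => (ih _ fun ν => hφ _).comp (measurable_pi_apply i)

/-- The counterpart for means: integrating out the last generation first puts its conditional mean
into the factors of generation n. -/
lemma boxMean_succ (L : Kernel E (ℕ → E)) (M n : ℕ) (φ : List ℕ → E → ℝ≥0∞) (x : E) :
    boxMean L M (n + 1) φ x = boxMean L M n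
      (mulLevel n φ fun ν x => ∫⁻ f, ∏ i ∈ Finset.range M, φ (i :: ν) (f i) ∂(L x)) x := by
  induction n generalizing φ x with
  | zero => simp [boxMean, mulLevel]
  | succ n ih =>
    rw [boxMean, boxMean]
    simp only [mulLevel_append]
    simp only [ih]
    have : mulLevel (n + 1) φ (fun ν x => ∫⁻ f, ∏ i ∈ Finset.range M, φ (i :: ν) (f i) ∂(L x)) [] x =
      φ [] x := by simp [mulLevel]
    rw [this]
    rfl

lemma lintegral_boxProd (μ₀ : Measure E) [IsProbabilityMeasure μ₀]
    (L : Kernel E (ℕ → E)) [IsMarkovKernel L] (M n : ℕ)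
    (φ : List ℕ → E → ℝ≥0∞) (hφ : ∀ ν, Measurable (φ ν)) :
    ∫⁻ T, boxProd M n φ T ∂(branchingLaw μ₀ L) = ∫⁻ x, boxMean L M n φ x ∂μ₀ := by
  induction n generalizing φ with
  | zero => exact branchingLaw_lintegral_root μ₀ L _ (hφ [])
  | succ n ih =>
    have hg : ∀ ν, Measurable fun f : ℕ → E => ∏ i ∈ Finset.range M, φ (i :: ν) (f i) := fun ν =>
      Finset.measurable_prod _ fun i _ => (hφ _).comp (measurable_pi_apply i)
    simp only [boxProd_succ, boxMean_succ]
    rw [branchingLaw_lintegral_succ μ₀ L n (boxProd M n φ) (measurable_boxProd M n φ hφ)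
      (boxProd_congr M n φ) (levelBox M n) (fun ν => length_of_mem_levelBox)
      (fun ν f => ∏ i ∈ Finset.range M, φ (i :: ν) (f i)) hg, ← ih]
    · refine lintegral_congr fun T => ?_
      rw [boxProd_mulLevel]
    · intro ν
      unfold mulLevel
      split_ifs
      · exact (hφ ν).mul (hg ν).lintegral_kernel
      · exact hφ ν

end Branching

/-! ### Subtrees at the children of the root as independent branching fields. -/

section BranchingProperty

variable {E : Type*} [MeasurableSpace E]

/-- The fields with `T ν ∈ t ν` for the words `ν` of length at most `n` with letters smaller
than `M`. -/
def boxCyl (M n : ℕ) (t : List ℕ → Set E) : Set (List ℕ → E) :=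
  {T | ∀ ν : List ℕ, ν.length ≤ n → (∀ i ∈ ν, i < M) → T ν ∈ t ν}

omit [MeasurableSpace E] in
lemma mem_boxCyl_succ (M n : ℕ) (t : List ℕ → Set E) (T : List ℕ → E) :
    T ∈ boxCyl M (n + 1) t ↔
      T [] ∈ t [] ∧ ∀ i ∈ Finset.range M, child i T ∈ boxCyl M n (fun ν => t (ν ++ [i])) := by
  constructor
  · intro h
    refine ⟨h [] (by simp) (by simp), fun i hi ν hν hM => h (ν ++ [i]) (by simpa using hν) ?_⟩
    intro j hj
    rcases List.mem_append.1 hj with hj | hj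
    · exact hM j hj
    · rw [List.mem_singleton.1 hj]; exact Finset.mem_range.1 hi
  · rintro ⟨h0, h⟩ ν hν hM
    rcases List.eq_nil_or_concat ν with rfl | ⟨μ, i, rfl⟩
    · exact h0
    · rw [List.concat_eq_append] at hν hM ⊢
      refine h i (Finset.mem_range.2 (hM i (by simp))) μ (by simpa using hν) fun j hj => hM j ?_
      simp [hj]

lemma measurableSet_boxCyl (M n : ℕ) (t : List ℕ → Set E) (ht : ∀ ν, MeasurableSet (t ν)) :
    MeasurableSet (boxCyl M n t) := by
  have : boxCyl M n t = ⋂ ν : List ℕ, ⋂ (_ : ν.length ≤ n), ⋂ (_ : ∀ i ∈ ν, i < M),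
      {T : List ℕ → E | T ν ∈ t ν} := by
    ext T; simp [boxCyl]
  rw [this]
  exact MeasurableSet.iInter fun ν => MeasurableSet.iInter fun _ => MeasurableSet.iInter fun _ =>
    measurableSet_preimage (f := fun T : List ℕ → E => T ν) (measurable_pi_apply ν) (ht ν)

omit [MeasurableSpace E] in
open Classical in
lemma boxProd_indicator (M n : ℕ) (t : List ℕ → Set E) (T : List ℕ → E) :
    boxProd M n (fun ν => (t ν).indicator 1) T = (boxCyl M n t).indicator 1 T := by
  induction n generalizing t T with
  | zero =>
    have : T ∈ boxCyl M 0 t ↔ T [] ∈ t [] := by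
      refine ⟨fun h => h [] (by simp) (by simp), fun h ν hν _ => ?_⟩
      obtain rfl : ν = [] := by simpa using hν
      exact h
    simp only [boxProd, Set.indicator_apply, this, Pi.one_apply]
  | succ n ih =>
    have ih' : ∀ i, boxProd M n (fun ν => (t (ν ++ [i])).indicator 1) (child i T) =
        (boxCyl M n (fun ν => t (ν ++ [i]))).indicator 1 (child i T) := fun i => ih _ _
    simp only [boxProd, ih', Set.indicator_apply, Pi.one_apply, mem_boxCyl_succ]
    rw [Finset.prod_ite_zero]
    by_cases h1 : T [] ∈ t [] <;> simp [h1]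

lemma branchingLaw_boxCyl (μ₀ : Measure E) [IsProbabilityMeasure μ₀]
    (L : Kernel E (ℕ → E)) [IsMarkovKernel L] (M n : ℕ) (t : List ℕ → Set E)
    (ht : ∀ ν, MeasurableSet (t ν)) :
    branchingLaw μ₀ L (boxCyl M n t) =
      ∫⁻ x, boxMean L M n (fun ν => (t ν).indicator 1) x ∂μ₀ := by
  rw [← lintegral_boxProd μ₀ L M n _ fun ν => measurable_one.indicator (ht ν),
    ← lintegral_indicator_one (measurableSet_boxCyl M n t ht)]
  exact lintegral_congr fun T => (boxProd_indicator M n t T).symm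

lemma branchingLaw_dirac_boxCyl (L : Kernel E (ℕ → E)) [IsMarkovKernel L] (M n : ℕ)
    (t : List ℕ → Set E) (ht : ∀ ν, MeasurableSet (t ν)) (x : E) :
    branchingLaw (Measure.dirac x) L (boxCyl M n t) =
      boxMean L M n (fun ν => (t ν).indicator 1) x := by
  rw [branchingLaw_boxCyl _ _ _ _ _ ht, lintegral_dirac' _ (measurable_boxMean L M n _
    fun ν => measurable_one.indicator (ht ν))]

lemma exists_box_bound (s : Finset (List ℕ)) :
    ∃ M n : ℕ, ∀ ν ∈ s, ν.length ≤ n ∧ ∀ i ∈ ν, i < M := by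
  refine ⟨s.sup List.sum + 1, s.sup List.length, fun ν hν => ⟨Finset.le_sup (f := List.length) hν,
    fun i hi => Nat.lt_succ_of_le ?_⟩⟩
  exact (List.single_le_sum (fun _ _ => Nat.zero_le _) i hi).trans (Finset.le_sup (f := List.sum) hν)

/-- Finitely many words fit into one box, and words without a constraint receive the whole space.
This gives the generating cylinders the recursive form that `boxMean` computes. -/
lemma squareCylinder_eq_boxCyl (s : Finset (List ℕ)) (t : List ℕ → Set E)
    (ht : ∀ ν, MeasurableSet (t ν)) : ∃ (M n : ℕ) (t' : List ℕ → Set E),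
      (∀ ν, MeasurableSet (t' ν)) ∧ (s : Set (List ℕ)).pi t = boxCyl M n t' := by
  classical
  obtain ⟨M, n, h⟩ := exists_box_bound s
  refine ⟨M, n, fun ν => if ν ∈ s then t ν else Set.univ, fun ν => ?_, ?_⟩
  · beta_reduce
    split_ifs
    · exact ht ν
    · exact MeasurableSet.univ
  · ext T
    simp only [Set.mem_pi, Finset.mem_coe]
    constructor
    · intro hT ν _ _
      beta_reduce
      split_ifs with hν
      · exact hT ν hν
      · trivial
    · intro hT ν hν
      have := hT ν (h ν hν).1 (h ν hν).2
      simp only [if_pos hν] at this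
      exact this

/-- The law of the branching field as a kernel from the root value. -/
noncomputable def branchingKernel (L : Kernel E (ℕ → E)) [IsMarkovKernel L] :
    Kernel E (List ℕ → E) where
  toFun x := branchingLaw (Measure.dirac x) L
  measurable' := by
    refine Measurable.measure_of_isPiSystem_of_isProbabilityMeasure
      (generateFrom_squareCylinders (α := fun _ : List ℕ => E)).symm
      (isPiSystem_squareCylinders (fun _ => MeasurableSpace.isPiSystem_measurableSet) (by simp)) ?_
    rintro _ ⟨s, t, ht, rfl⟩
    obtain ⟨M, n, t', ht', e⟩ := squareCylinder_eq_boxCyl s t fun i => by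
      simpa using ht i (Set.mem_univ i)
    rw [e]
    simp_rw [branchingLaw_dirac_boxCyl L M n t' ht']
    exact measurable_boxMean L M n _ fun ν => measurable_one.indicator (ht' ν)

instance (L : Kernel E (ℕ → E)) [IsMarkovKernel L] : IsMarkovKernel (branchingKernel L) :=
  ⟨fun x => inferInstanceAs (IsProbabilityMeasure (branchingLaw (Measure.dirac x) L))⟩

lemma branchingKernel_apply (L : Kernel E (ℕ → E)) [IsMarkovKernel L] (x : E) :
    branchingKernel L x = branchingLaw (Measure.dirac x) L := rfl

lemma branchingLaw_eq_bind (μ₀ : Measure E) [IsProbabilityMeasure μ₀]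
    (L : Kernel E (ℕ → E)) [IsMarkovKernel L] :
    branchingLaw μ₀ L = μ₀.bind (branchingKernel L) := by
  refine ext_of_generate_finite _ (generateFrom_squareCylinders (α := fun _ : List ℕ => E)).symm
    (isPiSystem_squareCylinders (fun _ => MeasurableSpace.isPiSystem_measurableSet) (by simp)) ?_
    (by simp)
  rintro _ ⟨s, t, ht, rfl⟩
  obtain ⟨M, n, t', ht', e⟩ := squareCylinder_eq_boxCyl s t fun i => by
    simpa using ht i (Set.mem_univ i)
  rw [e, branchingLaw_boxCyl _ _ _ _ _ ht', Measure.bind_apply (measurableSet_boxCyl M n t' ht')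
    (Kernel.aemeasurable _)]
  simp_rw [branchingKernel_apply, branchingLaw_dirac_boxCyl L M n t' ht']

lemma lintegral_branchingLaw (μ₀ : Measure E) [IsProbabilityMeasure μ₀]
    (L : Kernel E (ℕ → E)) [IsMarkovKernel L] (Φ : (List ℕ → E) → ℝ≥0∞) (hΦ : Measurable Φ) :
    ∫⁻ T, Φ T ∂(branchingLaw μ₀ L) = ∫⁻ x, ∫⁻ T, Φ T ∂(branchingKernel L x) ∂μ₀ := by
  rw [branchingLaw_eq_bind, Measure.lintegral_bind (Kernel.aemeasurable _) hΦ.aemeasurable]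

/-- The branching property: the subtrees at the children of the root are independent given the
values at the children. -/
lemma branchingKernel_map_child (L : Kernel E (ℕ → E)) [IsMarkovKernel L] (x : E) :
    (branchingKernel L x).map (fun T i => child i T) =
      (productKernel ℕ (branchingKernel L) ∘ₖ L) x := by
  have hc : Measurable fun (T : List ℕ → E) (i : ℕ) => child i T :=
    measurable_pi_iff.2 measurable_child
  let e := (MeasurableEquiv.curry ℕ (List ℕ) E).symm
  have he : ∀ (g : ℕ → List ℕ → E) (q : ℕ × List ℕ), e g q = g q.1 q.2 := fun g q => rfl
  have := Measure.isProbabilityMeasure_map (μ := branchingKernel L x) hc.aemeasurable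
  -- Uncurrying gives a single product over ℕ × List ℕ, whose square cylinders form a generating
  -- π-system.
  refine e.map_measurableEquiv_injective ?_
  have i1 := Measure.isProbabilityMeasure_map
    (μ := (branchingKernel L x).map (fun T i => child i T)) e.measurable.aemeasurable
  have i2 := Measure.isProbabilityMeasure_map
    (μ := (productKernel ℕ (branchingKernel L) ∘ₖ L) x) e.measurable.aemeasurable
  refine ext_of_generate_finite _
    (generateFrom_squareCylinders (α := fun _ : ℕ × List ℕ => E)).symm
    (isPiSystem_squareCylinders (fun _ => MeasurableSpace.isPiSystem_measurableSet) (by simp)) ?_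
    (by simp)
  rintro _ ⟨s, t, ht, rfl⟩
  have ht : ∀ q, MeasurableSet (t q) := fun i => by simpa using ht i (Set.mem_univ i)
  classical
  obtain ⟨M, n, hs⟩ := exists_box_bound (s.image fun q => q.2 ++ [q.1])
  let t' : ℕ → List ℕ → Set E := fun i ν => if (i, ν) ∈ s then t (i, ν) else Set.univ
  have ht' : ∀ i ν, MeasurableSet (t' i ν) := fun i ν => by
    simp only [t']
    split_ifs
    · exact ht _
    · exact MeasurableSet.univ
  have hpre : e ⁻¹' ((s : Set (ℕ × List ℕ)).pi t) =
      ((Finset.range M : Finset ℕ) : Set ℕ).pi fun i => boxCyl M n (t' i) := by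
    ext g
    simp only [Set.mem_preimage, Set.mem_pi, Finset.mem_coe, Finset.mem_range]
    constructor
    · intro hg i _ ν _ _
      simp only [t']
      split_ifs with hν
      · exact hg _ hν
      · trivial
    · rintro hg ⟨i, ν⟩ hq
      have hb := hs _ (Finset.mem_image_of_mem _ hq)
      have := hg i (hb.2 i (by simp)) ν (by
        have := hb.1
        simp only [List.length_append, List.length_singleton] at this
        omega) fun j hj => hb.2 j (by simp [hj])
      simp only [t', if_pos hq] at this
      exact this
  have hpim : MeasurableSet (((Finset.range M : Finset ℕ) : Set ℕ).pi fun i => boxCyl M n (t' i)) :=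
    MeasurableSet.pi (Finset.countable_toSet _) fun i _ => measurableSet_boxCyl M n _ (ht' i)
  -- The last letter of a word is the first step from the root, so it selects the child and the
  -- remaining letters locate the word in that child's subtree. The root itself is left
  -- unconstrained.
  let t₀ : List ℕ → Set E := fun ν =>
    if h : ν = [] then Set.univ else t' (ν.getLast h) ν.dropLast
  have ht₀ : ∀ ν, MeasurableSet (t₀ ν) := fun ν => by
    simp only [t₀]
    split_ifs
    · exact MeasurableSet.univ
    · exact ht' _ _
  have ht₀' : ∀ i ν, t₀ (ν ++ [i]) = t' i ν := fun i ν => by simp [t₀]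
  have hpre2 : (fun (T : List ℕ → E) (i : ℕ) => child i T) ⁻¹'
      (((Finset.range M : Finset ℕ) : Set ℕ).pi fun i => boxCyl M n (t' i)) =
        boxCyl M (n + 1) t₀ := by
    ext T
    rw [mem_boxCyl_succ]
    simp only [ht₀', Set.mem_preimage, Set.mem_pi, Finset.mem_coe]
    have : T [] ∈ t₀ [] := by simp [t₀]
    simp only [this, true_and]
  rw [e.map_apply, e.map_apply, hpre, Measure.map_apply hc hpim, hpre2, branchingKernel_apply,
    branchingLaw_dirac_boxCyl L M (n + 1) t₀ ht₀, Kernel.comp_apply' _ _ _ hpim, boxMean]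
  have h0 : (t₀ []).indicator (1 : E → ℝ≥0∞) x = 1 := by simp [t₀]
  rw [h0, one_mul]
  refine lintegral_congr fun f => ?_
  change _ = Measure.infinitePi (fun i => branchingKernel L (f i)) _
  rw [Measure.infinitePi_pi _ fun i _ => measurableSet_boxCyl M n _ (ht' i)]
  refine Finset.prod_congr rfl fun i _ => ?_
  rw [branchingKernel_apply, branchingLaw_dirac_boxCyl L M n _ (ht' i)]
  simp only [ht₀']

lemma lintegral_child (L : Kernel E (ℕ → E)) [IsMarkovKernel L] (x : E)
    (Φ : (List ℕ → E) → ℝ≥0∞) (hΦ : Measurable Φ) (i : ℕ) :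
    ∫⁻ T, Φ (child i T) ∂(branchingKernel L x) =
      ∫⁻ f, ∫⁻ T, Φ T ∂(branchingKernel L (f i)) ∂(L x) := by
  have hc : Measurable fun (T : List ℕ → E) (i : ℕ) => child i T :=
    measurable_pi_iff.2 measurable_child
  have hm : Measurable fun g : ℕ → List ℕ → E => Φ (g i) := hΦ.comp (measurable_pi_apply i)
  rw [← lintegral_map (f := fun g : ℕ → List ℕ → E => Φ (g i)) hm hc, branchingKernel_map_child,
    Kernel.lintegral_comp _ _ _ hm]
  refine lintegral_congr fun f => ?_
  change ∫⁻ g, Φ (g i) ∂(Measure.infinitePi (fun i => branchingKernel L (f i))) = _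
  rw [← lintegral_map hΦ (measurable_pi_apply i), Measure.infinitePi_map_eval]

lemma lintegral_child_mul (L : Kernel E (ℕ → E)) [IsMarkovKernel L] (x : E)
    (Φ : (List ℕ → E) → ℝ≥0∞) (hΦ : Measurable Φ) {i j : ℕ} (hij : i ≠ j) :
    ∫⁻ T, Φ (child i T) * Φ (child j T) ∂(branchingKernel L x) =
      ∫⁻ f, (∫⁻ T, Φ T ∂(branchingKernel L (f i))) * (∫⁻ T, Φ T ∂(branchingKernel L (f j)))
        ∂(L x) := by
  have hc : Measurable fun (T : List ℕ → E) (i : ℕ) => child i T :=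
    measurable_pi_iff.2 measurable_child
  have hm : Measurable fun g : ℕ → List ℕ → E => Φ (g i) * Φ (g j) :=
    (hΦ.comp (measurable_pi_apply i)).mul (hΦ.comp (measurable_pi_apply j))
  rw [← lintegral_map (f := fun g : ℕ → List ℕ → E => Φ (g i) * Φ (g j)) hm hc,
    branchingKernel_map_child, Kernel.lintegral_comp _ _ _ hm]
  refine lintegral_congr fun f => ?_
  change ∫⁻ g, Φ (g i) * Φ (g j) ∂(Measure.infinitePi (fun i => branchingKernel L (f i))) = _
  have hind := (iIndepFun_infinitePi (P := fun i => branchingKernel L (f i))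
    (X := fun _ => Φ) fun _ => hΦ).indepFun hij
  have h1 : ∀ k, ∫⁻ g, Φ (g k) ∂(Measure.infinitePi (fun i => branchingKernel L (f i))) =
      ∫⁻ T, Φ T ∂(branchingKernel L (f k)) := fun k => by
    rw [← lintegral_map hΦ (measurable_pi_apply k), Measure.infinitePi_map_eval]
  rw [← h1 i, ← h1 j]
  exact lintegral_mul_eq_lintegral_mul_lintegral_of_indepFun
    (hΦ.comp (measurable_pi_apply i)) (hΦ.comp (measurable_pi_apply j)) hind

lemma branchingKernel_ae_root [MeasurableSingletonClass E] (L : Kernel E (ℕ → E))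
    [IsMarkovKernel L] (x : E) : ∀ᵐ T ∂(branchingKernel L x), T [] = x := by
  have hs : MeasurableSet ({x}ᶜ : Set E) := (measurableSet_singleton x).compl
  have h := branchingLaw_lintegral_root (Measure.dirac x) L _ (measurable_one.indicator hs)
  rw [lintegral_dirac' _ (measurable_one.indicator hs), ← branchingKernel_apply] at h
  simp only [Set.mem_compl_iff, Set.mem_singleton_iff, not_true_eq_false, not_false_eq_true,
    Set.indicator_of_notMem] at h
  rw [lintegral_eq_zero_iff (f := fun T : List ℕ → E => ({x}ᶜ : Set E).indicator 1 (T []))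
    ((measurable_one.indicator hs).comp (measurable_pi_apply _))] at h
  filter_upwards [h] with T hT
  by_contra hne
  simp [hne] at hT

end BranchingProperty


/-! ### First and second moments over the children of the root. -/

section EnvironmentMeans

variable {S : Type*} [MeasurableSpace S]

lemma lintegral_envLaw (p : PMF ℕ) (J : Kernel (ℕ × State S) (ℕ → State S)) [IsMarkovKernel J]
    (μ₀ : Measure (State S)) [IsProbabilityMeasure μ₀] (Φ : Env S → ℝ≥0∞) (hΦ : Measurable Φ) :
    ∫⁻ e, Φ e ∂(envLaw p J μ₀) =
      ∫⁻ y, ∫⁻ k, ∫⁻ e, Φ e ∂(branchingKernel (familyKernel p J) (k, y)) ∂p.toMeasure ∂μ₀ := by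
  rw [envLaw, lintegral_branchingLaw _ _ _ hΦ]
  rw [lintegral_prod_symm _ hΦ.lintegral_kernel.aemeasurable]

lemma lintegral_envLaw_dirac (p : PMF ℕ) (J : Kernel (ℕ × State S) (ℕ → State S))
    [IsMarkovKernel J] (y : State S) (Φ : Env S → ℝ≥0∞) (hΦ : Measurable Φ) :
    ∫⁻ e, Φ e ∂(envLaw p J (Measure.dirac y)) =
      ∫⁻ k, ∫⁻ e, Φ e ∂(branchingKernel (familyKernel p J) (k, y)) ∂p.toMeasure := by
  rw [lintegral_envLaw _ _ _ _ hΦ, lintegral_dirac']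
  exact Measurable.lintegral_prod_left' (f := fun q : ℕ × State S =>
    ∫⁻ e, Φ e ∂(branchingKernel (familyKernel p J) q)) hΦ.lintegral_kernel

lemma measurable_lintegral_envLaw_dirac (p : PMF ℕ) (J : Kernel (ℕ × State S) (ℕ → State S))
    [IsMarkovKernel J] (Φ : Env S → ℝ≥0∞) (hΦ : Measurable Φ) :
    Measurable fun y => ∫⁻ e, Φ e ∂(envLaw p J (Measure.dirac y)) := by
  simp_rw [lintegral_envLaw_dirac p J _ Φ hΦ]
  exact Measurable.lintegral_prod_left' (f := fun q : ℕ × State S =>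
    ∫⁻ e, Φ e ∂(branchingKernel (familyKernel p J) q)) hΦ.lintegral_kernel

lemma lintegral_envLaw_eq (p : PMF ℕ) (J : Kernel (ℕ × State S) (ℕ → State S)) [IsMarkovKernel J]
    (μ₀ : Measure (State S)) [IsProbabilityMeasure μ₀] (Φ : Env S → ℝ≥0∞) (hΦ : Measurable Φ) :
    ∫⁻ e, Φ e ∂(envLaw p J μ₀) = ∫⁻ y, ∫⁻ e, Φ e ∂(envLaw p J (Measure.dirac y)) ∂μ₀ := by
  rw [lintegral_envLaw _ _ _ _ hΦ]
  simp_rw [lintegral_envLaw_dirac p J _ Φ hΦ]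

lemma lintegral_familyKernel (p : PMF ℕ) (J : Kernel (ℕ × State S) (ℕ → State S))
    [IsMarkovKernel J] (x : ℕ × State S) (Φ : (ℕ → ℕ × State S) → ℝ≥0∞) (hΦ : Measurable Φ) :
    ∫⁻ f, Φ f ∂(familyKernel p J x) =
      ∫⁻ z, ∫⁻ k, Φ (fun i => (k i, z i)) ∂(Measure.infinitePi fun _ : ℕ => p.toMeasure)
        ∂(J x) := by
  have hm : Measurable fun (q : (ℕ → ℕ) × (ℕ → State S)) (i : ℕ) => (q.1 i, q.2 i) := by fun_prop
  rw [familyKernel, Kernel.map_apply _ hm, lintegral_map hΦ hm, Kernel.prod_apply,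
    Kernel.const_apply]
  exact lintegral_prod_symm _ (hΦ.comp hm).aemeasurable

variable (p : PMF ℕ) (J : Kernel (ℕ × State S) (ℕ → State S)) [IsMarkovKernel J]

/-- A child's offspring number is independent of its state. Integrating it out turns the field below
the child into an environment started from that state, so only the marginal K of the family law
enters. -/
lemma lintegral_child_env {K : Kernel (State S) (State S)} (hJ : HasMarginals J K) {i k : ℕ}
    (hik : i < k) (y : State S) (Φ : Env S → ℝ≥0∞) (hΦ : Measurable Φ) :
    ∫⁻ e, Φ (child i e) ∂(branchingKernel (familyKernel p J) (k, y)) =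
      ∫⁻ z, ∫⁻ e, Φ e ∂(envLaw p J (Measure.dirac z)) ∂(K y) := by
  set B := branchingKernel (familyKernel p J)
  have hB : Measurable fun x => ∫⁻ e, Φ e ∂(B x) := hΦ.lintegral_kernel
  rw [lintegral_child _ _ _ hΦ, lintegral_familyKernel p J (k, y) (fun f => ∫⁻ e, Φ e ∂(B (f i)))
    (hB.comp (measurable_pi_apply i))]
  rw [← hJ k y i hik, lintegral_map (measurable_lintegral_envLaw_dirac p J Φ hΦ)
    (measurable_pi_apply i)]
  refine lintegral_congr fun z => ?_
  rw [lintegral_envLaw_dirac p J _ Φ hΦ]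
  have := lintegral_map (μ := Measure.infinitePi fun _ : ℕ => p.toMeasure)
    (f := fun k => ∫⁻ e, Φ e ∂(B (k, z i))) (hB.comp (by fun_prop))
    (measurable_pi_apply i)
  rw [Measure.infinitePi_map_eval] at this
  exact this.symm

/-- Given the states of two siblings, their subtrees are independent with means at most C whatever
these states are. Dependence between the states is therefore harmless. -/
lemma lintegral_child_mul_env_le {i j : ℕ} (hij : i ≠ j) (x : ℕ × State S) (Φ : Env S → ℝ≥0∞)
    (hΦ : Measurable Φ) {C : ℝ≥0∞} (hC : ∀ z, ∫⁻ e, Φ e ∂(envLaw p J (Measure.dirac z)) ≤ C) :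
    ∫⁻ e, Φ (child i e) * Φ (child j e) ∂(branchingKernel (familyKernel p J) x) ≤ C * C := by
  set B := branchingKernel (familyKernel p J)
  have hB : Measurable fun x => ∫⁻ e, Φ e ∂(B x) := hΦ.lintegral_kernel
  rw [lintegral_child_mul _ _ _ hΦ hij, lintegral_familyKernel p J x
    (fun f => (∫⁻ e, Φ e ∂(B (f i))) * ∫⁻ e, Φ e ∂(B (f j)))
    ((hB.comp (measurable_pi_apply i)).mul (hB.comp (measurable_pi_apply j)))]
  have hbound : ∀ z : ℕ → State S, ∫⁻ k : ℕ → ℕ, (∫⁻ e, Φ e ∂(B (k i, z i))) *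
      (∫⁻ e, Φ e ∂(B (k j, z j))) ∂(Measure.infinitePi fun _ : ℕ => p.toMeasure) ≤ C * C := by
    intro z
    have hg : ∀ l, Measurable fun k : ℕ => ∫⁻ e, Φ e ∂(B (k, z l)) := fun l =>
      hB.comp (by fun_prop)
    have hind := (iIndepFun_infinitePi (P := fun _ : ℕ => p.toMeasure)
      (X := fun l k => ∫⁻ e, Φ e ∂(B (k, z l))) hg).indepFun hij
    have h1 : ∀ l, ∫⁻ k : ℕ → ℕ, (∫⁻ e, Φ e ∂(B (k l, z l)))
        ∂(Measure.infinitePi fun _ : ℕ => p.toMeasure) ≤ C := fun l => by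
      have := lintegral_map (μ := Measure.infinitePi fun _ : ℕ => p.toMeasure)
        (f := fun k => ∫⁻ e, Φ e ∂(B (k, z l))) (hg l) (measurable_pi_apply l)
      rw [Measure.infinitePi_map_eval, ← lintegral_envLaw_dirac p J _ Φ hΦ] at this
      rw [← this]
      exact hC (z l)
    refine (lintegral_mul_eq_lintegral_mul_lintegral_of_indepFun
      ((hg i).comp (measurable_pi_apply i)) ((hg j).comp (measurable_pi_apply j)) hind).trans_le ?_
    exact mul_le_mul' (h1 i) (h1 j)
  calc _ ≤ ∫⁻ z, C * C ∂(J x) := lintegral_mono hbound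
    _ = _ := by simp

/-- The mean of the number of offspring, cut at `D`. -/
noncomputable def cutMean (D : ℕ) : ℝ≥0∞ := ∫⁻ k, ((min k D : ℕ) : ℝ≥0∞) ∂p.toMeasure

lemma cutMean_le (D : ℕ) : cutMean p D ≤ D := by
  calc cutMean p D ≤ ∫⁻ _, (D : ℝ≥0∞) ∂p.toMeasure :=
        lintegral_mono fun k => Nat.cast_le.2 (min_le_right k D)
    _ = D := by simp

variable [MeasurableSingletonClass S]

lemma branchingKernel_ae_offspring (x : ℕ × State S) :
    ∀ᵐ e ∂(branchingKernel (familyKernel p J) x), Env.offspring e [] = x.1 := by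
  filter_upwards [branchingKernel_ae_root (familyKernel p J) x] with e he
  rw [Env.offspring, he]

lemma envLaw_dirac_ae_root (y : State S) :
    ∀ᵐ e ∂(envLaw p J (Measure.dirac y)), (e []).2 = y := by
  have hs : MeasurableSet {e : Env S | (e []).2 = y}ᶜ :=
    (measurableSet_preimage (f := fun e : Env S => (e []).2)
      (measurable_snd.comp (measurable_pi_apply [])) (measurableSet_singleton y)).compl
  rw [ae_iff]
  change (envLaw p J (Measure.dirac y)) {e : Env S | (e []).2 = y}ᶜ = 0
  rw [← lintegral_indicator_one hs, lintegral_envLaw_dirac p J y _ (measurable_one.indicator hs)]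
  refine (lintegral_congr fun k => ?_).trans lintegral_zero
  rw [lintegral_indicator_one hs]
  have := branchingKernel_ae_root (familyKernel p J) (k, y)
  rw [ae_iff] at this
  refine measure_mono_null (fun e he => ?_) this
  intro h
  exact he (by rw [Set.mem_ofPred_eq, h])

omit [MeasurableSingletonClass S] in
lemma measurable_offspring : Measurable fun e : Env S => e.offspring [] :=
  measurable_fst.comp (measurable_pi_apply [])

lemma measurable_sum_range {Ω R : Type*} [MeasurableSpace Ω] [AddCommMonoid R] [MeasurableSpace R]
    [MeasurableAdd₂ R] {n : Ω → ℕ} (hn : Measurable n) {f : ℕ → Ω → R} (hf : ∀ i, Measurable (f i)) :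
    Measurable fun e => ∑ i ∈ Finset.range (n e), f i e := by
  have h : Measurable fun q : ℕ × Ω => ∑ i ∈ Finset.range q.1, f i q.2 :=
    measurable_from_prod_countable_right fun k =>
      Finset.measurable_sum (Finset.range k) fun i _ => hf i
  exact h.comp (hn.prodMk measurable_id)

/-- The one-generation many-to-one formula: by linearity, a sum over children is the cut mean
offspring number times one step of the chain along a line of descent. -/
lemma lintegral_sum_child {K : Kernel (State S) (State S)} (hJ : HasMarginals J K) (D : ℕ)
    (y : State S) (Φ : Env S → ℝ≥0∞) (hΦ : Measurable Φ) :
    ∫⁻ e, ∑ i ∈ Finset.range (min (e.offspring []) D), Φ (child i e)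
        ∂(envLaw p J (Measure.dirac y)) =
      cutMean p D * ∫⁻ z, ∫⁻ e, Φ e ∂(envLaw p J (Measure.dirac z)) ∂(K y) := by
  have hc : ∀ i, Measurable fun e : Env S => Φ (child i e) := fun i => hΦ.comp (measurable_child i)
  rw [lintegral_envLaw_dirac p J y _
    (measurable_sum_range (measurable_offspring.min measurable_const) hc), cutMean,
    ← lintegral_mul_const _ (measurable_of_countable _)]
  refine lintegral_congr fun k => ?_
  calc _ = ∫⁻ e, ∑ i ∈ Finset.range (min k D), Φ (child i e)
        ∂(branchingKernel (familyKernel p J) (k, y)) := by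
        refine lintegral_congr_ae ?_
        filter_upwards [branchingKernel_ae_offspring p J (k, y)] with e he
        rw [he]
    _ = ∑ i ∈ Finset.range (min k D), ∫⁻ z, ∫⁻ e, Φ e ∂(envLaw p J (Measure.dirac z)) ∂(K y) := by
        rw [lintegral_finsetSum _ fun i _ => hc i]
        refine Finset.sum_congr rfl fun i hi => ?_
        exact lintegral_child_env p J hJ
          ((Finset.mem_range.1 hi).trans_le (min_le_left _ _)) y Φ hΦ
    _ = _ := by rw [Finset.sum_const, Finset.card_range, nsmul_eq_mul]

omit [MeasurableSingletonClass S] in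
lemma lintegral_sum_child_mul_le (D : ℕ) (y : State S) (Φ : Env S → ℝ≥0∞) (hΦ : Measurable Φ)
    {C : ℝ≥0∞} (hC : ∀ z, ∫⁻ e, Φ e ∂(envLaw p J (Measure.dirac z)) ≤ C) :
    ∫⁻ e, ∑ i ∈ Finset.range (min (e.offspring []) D),
        ∑ j ∈ (Finset.range (min (e.offspring []) D)).erase i, Φ (child i e) * Φ (child j e)
        ∂(envLaw p J (Measure.dirac y)) ≤ D * (D * (C * C)) := by
  have hc : ∀ i, Measurable fun e : Env S => Φ (child i e) := fun i => hΦ.comp (measurable_child i)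
  have hle : ∀ e : Env S, ∑ i ∈ Finset.range (min (e.offspring []) D),
      ∑ j ∈ (Finset.range (min (e.offspring []) D)).erase i, Φ (child i e) * Φ (child j e) ≤
        ∑ i ∈ Finset.range D, ∑ j ∈ (Finset.range D).erase i, Φ (child i e) * Φ (child j e) := by
    intro e
    have hsub : Finset.range (min (e.offspring []) D) ⊆ Finset.range D :=
      Finset.range_mono (min_le_right _ _)
    exact (Finset.sum_le_sum fun i _ =>
      Finset.sum_le_sum_of_subset (Finset.erase_subset_erase i hsub)).trans
      (Finset.sum_le_sum_of_subset hsub)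
  have hm : ∀ i j, Measurable fun e : Env S => Φ (child i e) * Φ (child j e) := fun i j =>
    (hc i).mul (hc j)
  refine (lintegral_mono hle).trans ?_
  rw [lintegral_envLaw_dirac p J y _ (Finset.measurable_sum _ fun i _ =>
    Finset.measurable_sum _ fun j _ => hm i j)]
  calc _ ≤ ∫⁻ _, (D : ℝ≥0∞) * (D * (C * C)) ∂p.toMeasure := by
        refine lintegral_mono fun k => ?_
        beta_reduce
        rw [lintegral_finsetSum _ fun i _ => Finset.measurable_sum _ fun j _ => hm i j]
        calc _ ≤ ∑ i ∈ Finset.range D, (D : ℝ≥0∞) * (C * C) := by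
              refine Finset.sum_le_sum fun i _ => ?_
              rw [lintegral_finsetSum _ fun j _ => hm i j]
              calc _ ≤ ∑ j ∈ (Finset.range D).erase i, C * C :=
                    Finset.sum_le_sum fun j hj => lintegral_child_mul_env_le p J
                      (Finset.ne_of_mem_erase hj).symm (k, y) Φ hΦ hC
                _ ≤ ∑ j ∈ Finset.range D, C * C :=
                    Finset.sum_le_sum_of_subset (Finset.erase_subset _ _)
                _ = _ := by rw [Finset.sum_const, Finset.card_range, nsmul_eq_mul]
          _ = _ := by rw [Finset.sum_const, Finset.card_range, nsmul_eq_mul]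
    _ = _ := by simp

end EnvironmentMeans

/-! ### Conductances of finite trees -/

section Conductance

variable {S : Type*}

/-- The first `D` children of the root. -/
def kids (D : ℕ) (e : Env S) : Finset ℕ := Finset.range (min (e.offspring []) D)

/-- The weight on the edge between the root and its parent. -/
def rootWeight (e : Env S) : ℝ := e.weight []

lemma rootWeight_pos (e : Env S) : 0 < rootWeight e := State.weight_pos _

/-- The probability that the walk started at the root of the tree in which each vertex keeps its
first `D` children succeeds before it visits the parent of the root, when at each visit to a
vertex of generation `n` it either succeeds, which happens with a probability given by `t`, or
returns to the parent. -/
noncomputable def escapeProb (D : ℕ) : ℕ → (Env S → ℝ) → Env S → ℝ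
  | 0, t, e => t e
  | n + 1, t, e =>
    (∑ i ∈ kids D e, rootWeight (child i e) * escapeProb D n t (child i e)) /
      (1 + ∑ i ∈ kids D e, rootWeight (child i e) * escapeProb D n t (child i e))

/-- The sum of `t / (a + c * R)` over generation `n` of the tree, where `R` is the resistance
between the vertex and the parent of the root. -/
noncomputable def rayFlow (D : ℕ) : ℕ → ℝ → ℝ → (Env S → ℝ) → Env S → ℝ
  | 0, a, c, t, e => t e / (a + c)
  | n + 1, a, c, t, e =>
    ∑ i ∈ kids D e, rayFlow D n (a + c) (c / rootWeight (child i e)) t (child i e)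

/-- The sum of `t` over generation `n` of the tree. -/
def levelSum (D : ℕ) : ℕ → (Env S → ℝ) → Env S → ℝ
  | 0, t, e => t e
  | n + 1, t, e => ∑ i ∈ kids D e, levelSum D n t (child i e)

/-- The sum of the products of the values of `t` over the pairs of distinct vertices of
generation `n` of the tree. -/
def pairSum (D : ℕ) : ℕ → (Env S → ℝ) → Env S → ℝ
  | 0, _, _ => 0
  | n + 1, t, e => ∑ i ∈ kids D e, pairSum D n t (child i e) +
      ∑ i ∈ kids D e, ∑ j ∈ (kids D e).erase i,
        levelSum D n t (child i e) * levelSum D n t (child j e)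

variable {D : ℕ} {t : Env S → ℝ}

lemma escapeProb_nonneg (ht : ∀ e, 0 ≤ t e) (n : ℕ) (e : Env S) : 0 ≤ escapeProb D n t e := by
  induction n generalizing e with
  | zero => exact ht e
  | succ n ih =>
    have : 0 ≤ ∑ i ∈ kids D e, rootWeight (child i e) * escapeProb D n t (child i e) :=
      Finset.sum_nonneg fun i _ => mul_nonneg (rootWeight_pos _).le (ih _)
    rw [escapeProb]
    positivity

lemma escapeProb_le_one (ht : ∀ e, 0 ≤ t e) (ht1 : ∀ e, t e ≤ 1) (n : ℕ) (e : Env S) :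
    escapeProb D n t e ≤ 1 := by
  cases n with
  | zero => exact ht1 e
  | succ n =>
    have : 0 ≤ ∑ i ∈ kids D e, rootWeight (child i e) * escapeProb D n t (child i e) :=
      Finset.sum_nonneg fun i _ => mul_nonneg (rootWeight_pos _).le (escapeProb_nonneg ht n _)
    rw [escapeProb, div_le_one (by positivity)]
    linarith

lemma div_one_add_mono {x y : ℝ} (hx : 0 ≤ x) (h : x ≤ y) : x / (1 + x) ≤ y / (1 + y) := by
  rw [div_le_div_iff₀ (by linarith) (by linarith)]
  nlinarith

lemma escapeProb_mono {t' : Env S → ℝ} (ht : ∀ e, 0 ≤ t e) (h : ∀ e, t e ≤ t' e) (n : ℕ)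
    (e : Env S) : escapeProb D n t e ≤ escapeProb D n t' e := by
  induction n generalizing e with
  | zero => exact h e
  | succ n ih =>
    exact div_one_add_mono
      (Finset.sum_nonneg fun i _ => mul_nonneg (rootWeight_pos _).le (escapeProb_nonneg ht n _))
      (Finset.sum_le_sum fun i _ => mul_le_mul_of_nonneg_left (ih _) (rootWeight_pos _).le)

lemma escapeProb_add (m n : ℕ) (e : Env S) :
    escapeProb D (m + n) t e = escapeProb D n (escapeProb D m t) e := by
  induction n generalizing e with
  | zero => rfl
  | succ n ih =>
    rw [← add_assoc, escapeProb, escapeProb]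
    simp only [ih]

lemma rayFlow_nonneg (ht : ∀ e, 0 ≤ t e) (n : ℕ) {a c : ℝ} (ha : 0 ≤ a) (hc : 0 ≤ c) (e : Env S) :
    0 ≤ rayFlow D n a c t e := by
  induction n generalizing a c e with
  | zero => exact div_nonneg (ht e) (by positivity)
  | succ n ih =>
    exact Finset.sum_nonneg fun i _ => ih (by positivity)
      (div_nonneg hc (rootWeight_pos _).le) _

lemma levelSum_nonneg (ht : ∀ e, 0 ≤ t e) (n : ℕ) (e : Env S) : 0 ≤ levelSum D n t e := by
  induction n generalizing e with
  | zero => exact ht e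
  | succ n ih => exact Finset.sum_nonneg fun i _ => ih _

lemma pairSum_nonneg (ht : ∀ e, 0 ≤ t e) (n : ℕ) (e : Env S) : 0 ≤ pairSum D n t e := by
  induction n generalizing e with
  | zero => exact le_rfl
  | succ n ih =>
    exact add_nonneg (Finset.sum_nonneg fun i _ => ih _) (Finset.sum_nonneg fun i _ =>
      Finset.sum_nonneg fun j _ => mul_nonneg (levelSum_nonneg ht n _) (levelSum_nonneg ht n _))

lemma mul_rayFlow_le (ht : ∀ e, 0 ≤ t e) (n : ℕ) {x a c : ℝ} (hx : 0 ≤ x) (ha : x ≤ a)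
    (hc : 0 < c) (e : Env S) : x * rayFlow D n a c t e ≤ levelSum D n t e := by
  induction n generalizing a c e with
  | zero =>
    have h0 : 0 < a + c := by linarith
    rw [rayFlow, levelSum, mul_div_assoc', div_le_iff₀ h0, mul_comm]
    exact mul_le_mul_of_nonneg_left (by linarith) (ht e)
  | succ n ih =>
    rw [rayFlow, levelSum, Finset.mul_sum]
    exact Finset.sum_le_sum fun i _ => ih (by linarith) (div_pos hc (rootWeight_pos _)) _

/-- Thomson's principle for the flow `rayFlow`. -/
lemma rayFlow_sq_mul_le (ht : ∀ e, 0 ≤ t e) (ht1 : ∀ e, t e ≤ 1) (n : ℕ) {a c : ℝ} (ha : 0 ≤ a)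
    (hc : 0 < c) (hac : 1 ≤ a + c) (e : Env S) :
    rayFlow D n a c t e ^ 2 * (a * escapeProb D n t e + c) ≤
      (rayFlow D n a c t e + pairSum D n t e) * escapeProb D n t e := by
  -- Divided by the escape probability F, the claim reads W² (a + c/F) ≤ W + V. The left side is the
  -- least energy of a flow of strength W through a resistance a in series with a network of
  -- resistance c/F; the right side bounds the energy of `rayFlow`. The multiplied form also covers
  -- F = 0.
  induction n generalizing a c e with
  | zero =>
    rw [rayFlow, pairSum, escapeProb, add_zero]
    have h0 : 0 < a + c := by linarith
    have h1 : a * t e + c ≤ a + c := by nlinarith [ht1 e]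
    calc (t e / (a + c)) ^ 2 * (a * t e + c) ≤ (t e / (a + c)) ^ 2 * (a + c) := by gcongr
      _ = _ := by field_simp
  | succ n ih =>
    set I := kids D e
    let A : ℕ → ℝ := fun i => rootWeight (child i e)
    let F : ℕ → ℝ := fun i => escapeProb D n t (child i e)
    let W : ℕ → ℝ := fun i => rayFlow D n (a + c) (c / A i) t (child i e)
    let V : ℕ → ℝ := fun i => pairSum D n t (child i e)
    let L : ℕ → ℝ := fun i => levelSum D n t (child i e)
    have hA : ∀ i, 0 < A i := fun i => rootWeight_pos _
    have hF : ∀ i, 0 ≤ F i := fun i => escapeProb_nonneg ht n _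
    have hW : ∀ i, 0 ≤ W i := fun i => rayFlow_nonneg ht n (by linarith)
      (div_nonneg hc.le (hA i).le) _
    have hV : ∀ i, 0 ≤ V i := fun i => pairSum_nonneg ht n _
    have hIH : ∀ i, W i ^ 2 * ((a + c) * F i + c / A i) ≤ (W i + V i) * F i := fun i =>
      ih (by linarith) (div_pos hc (hA i)) (by linarith [div_pos hc (hA i)]) _
    have hW0 : ∀ i, F i = 0 → W i = 0 := by
      intro i h
      have := hIH i
      rw [h, mul_zero, mul_zero, zero_add] at this
      have hp := div_pos hc (hA i)
      by_contra hne
      have : 0 < W i ^ 2 * (c / A i) := by positivity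
      linarith
    have hWL : ∀ i, (a + c) * W i ≤ L i := fun i =>
      mul_rayFlow_le ht n (by linarith) le_rfl (div_pos hc (hA i)) _
    have hWL' : ∀ i, W i ≤ L i := fun i => by nlinarith [hWL i, hW i]
    set Sm := ∑ i ∈ I, A i * F i
    have hS : 0 ≤ Sm := Finset.sum_nonneg fun i _ => mul_nonneg (hA i).le (hF i)
    set Wt := ∑ i ∈ I, W i
    -- Cauchy–Schwarz for branches in parallel with conductances `A i * F i`. A branch of zero
    -- conductance carries no flow, by `hW0`.
    have titu : Wt ^ 2 ≤ Sm * ∑ i ∈ I, W i ^ 2 / (A i * F i) := by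
      refine Finset.sum_sq_le_sum_mul_sum_of_sq_le_mul I (fun i _ => mul_nonneg (hA i).le (hF i))
        (fun i _ => by have := hA i; have := hF i; positivity) fun i _ => ?_
      by_cases h : F i = 0
      · rw [hW0 i h, h]; simp
      · have := hA i
        refine le_of_eq ?_
        field_simp
    have hdiag : ∀ i, W i ^ 2 * (a + c) + c * (W i ^ 2 / (A i * F i)) ≤ W i + V i := by
      intro i
      by_cases h : F i = 0
      · rw [hW0 i h]; simpa using hV i
      · have hFp : 0 < F i := lt_of_le_of_ne (hF i) (Ne.symm h)
        have hAp := hA i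
        have := hIH i
        rw [← div_le_iff₀ hFp] at this
        refine le_trans (le_of_eq ?_) this
        field_simp
    have hsq : Wt ^ 2 = ∑ i ∈ I, W i ^ 2 + ∑ i ∈ I, ∑ j ∈ I.erase i, W i * W j := by
      rw [sq, Finset.sum_mul_sum, ← Finset.sum_add_distrib]
      refine Finset.sum_congr rfl fun i hi => ?_
      rw [← Finset.add_sum_erase I _ hi, sq]
    -- Two branches interact through the shared resistance a + c. One factor W absorbs it by `hWL`;
    -- the other is bounded by `hWL'`, which needs 1 ≤ a + c.
    have hoff : (a + c) * ∑ i ∈ I, ∑ j ∈ I.erase i, W i * W j ≤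
        ∑ i ∈ I, ∑ j ∈ I.erase i, L i * L j := by
      rw [Finset.mul_sum]
      refine Finset.sum_le_sum fun i _ => ?_
      rw [Finset.mul_sum]
      refine Finset.sum_le_sum fun j _ => ?_
      rw [← mul_assoc]
      exact mul_le_mul (hWL i) (hWL' j) (hW j) (levelSum_nonneg ht n _)
    have hmain : Wt ^ 2 * (a + c) + c * ∑ i ∈ I, W i ^ 2 / (A i * F i) ≤
        Wt + (∑ i ∈ I, V i + ∑ i ∈ I, ∑ j ∈ I.erase i, L i * L j) := by
      have h1 : ∑ i ∈ I, (W i ^ 2 * (a + c) + c * (W i ^ 2 / (A i * F i))) ≤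
          ∑ i ∈ I, (W i + V i) := Finset.sum_le_sum fun i _ => hdiag i
      rw [Finset.sum_add_distrib, Finset.sum_add_distrib, ← Finset.sum_mul, ← Finset.mul_sum] at h1
      rw [hsq]
      linarith
    have e1 : rayFlow D (n + 1) a c t e = Wt := rfl
    have e2 : escapeProb D (n + 1) t e = Sm / (1 + Sm) := rfl
    have e3 : pairSum D (n + 1) t e =
        ∑ i ∈ I, V i + ∑ i ∈ I, ∑ j ∈ I.erase i, L i * L j := rfl
    rw [e1, e2, e3]
    set P := ∑ i ∈ I, V i + ∑ i ∈ I, ∑ j ∈ I.erase i, L i * L j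
    set Q := ∑ i ∈ I, W i ^ 2 / (A i * F i)
    have hS1 : 0 < 1 + Sm := by linarith
    have h2 : Wt ^ 2 * (a * Sm + c * (1 + Sm)) ≤ (Wt + P) * Sm := by
      calc Wt ^ 2 * (a * Sm + c * (1 + Sm)) = Wt ^ 2 * (a + c) * Sm + c * Wt ^ 2 := by ring
        _ ≤ Wt ^ 2 * (a + c) * Sm + c * (Sm * Q) := by gcongr
        _ = (Wt ^ 2 * (a + c) + c * Q) * Sm := by ring
        _ ≤ (Wt + P) * Sm := by gcongr
    calc Wt ^ 2 * (a * (Sm / (1 + Sm)) + c) = Wt ^ 2 * (a * Sm + c * (1 + Sm)) / (1 + Sm) := by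
          field_simp
      _ ≤ (Wt + P) * Sm / (1 + Sm) := by gcongr
      _ = _ := by ring

/-- Thomson's bound with a = 0 and c = 1 is W² ≤ (W + V) F. If W exceeded F + V, then F < W and (W +
V) F ≤ W (F + V) < W², a contradiction. -/
lemma rayFlow_le_escapeProb_add (ht : ∀ e, 0 ≤ t e) (ht1 : ∀ e, t e ≤ 1) (n : ℕ) (e : Env S) :
    rayFlow D n 0 1 t e ≤ escapeProb D n t e + pairSum D n t e := by
  have h := rayFlow_sq_mul_le (D := D) ht ht1 n le_rfl one_pos (by norm_num) e
  rw [zero_mul, zero_add, mul_one] at h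
  have hF := escapeProb_nonneg (D := D) ht n e
  have hV := pairSum_nonneg (D := D) ht n e
  have hW := rayFlow_nonneg (D := D) ht n le_rfl zero_le_one e
  set W := rayFlow D n 0 1 t e
  set V := pairSum D n t e
  set F := escapeProb D n t e
  by_contra hlt
  push Not at hlt
  nlinarith

end Conductance

/-! ### Mean escape probabilities -/

section MeanEscape

variable {S : Type*} [MeasurableSpace S]

lemma measurable_rootWeight : Measurable (rootWeight : Env S → ℝ) :=
  measurable_weight.comp (measurable_snd.comp (measurable_pi_apply []))

lemma measurable_kids_sum {R : Type*} [AddCommMonoid R] [MeasurableSpace R]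
    [MeasurableAdd₂ R] (D : ℕ) {f : ℕ → Env S → R} (hf : ∀ i, Measurable (f i)) :
    Measurable fun e => ∑ i ∈ kids D e, f i e :=
  measurable_sum_range (measurable_offspring.min measurable_const) hf

variable {D : ℕ} {t : Env S → ℝ}

lemma measurable_escapeProb (ht : Measurable t) (n : ℕ) : Measurable (escapeProb D n t) := by
  induction n with
  | zero => exact ht
  | succ n ih =>
    have : Measurable fun e : Env S =>
        ∑ i ∈ kids D e, rootWeight (child i e) * escapeProb D n t (child i e) :=
      measurable_kids_sum D fun i => (measurable_rootWeight.comp (measurable_child i)).mul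
        (ih.comp (measurable_child i))
    exact this.div (measurable_const.add this)

lemma measurable_rayFlow (ht : Measurable t) (n : ℕ) :
    Measurable fun q : ℝ × ℝ × Env S => rayFlow D n q.1 q.2.1 t q.2.2 := by
  induction n with
  | zero => exact (ht.comp (measurable_snd.comp measurable_snd)).div (by fun_prop)
  | succ n ih =>
    have hc : ∀ i, Measurable fun q : ℝ × ℝ × Env S => child i q.2.2 := fun i =>
      (measurable_child i).comp (measurable_snd.comp measurable_snd)
    refine measurable_sum_range (Ω := ℝ × ℝ × Env S) (n := fun q => min (q.2.2.offspring []) D)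
      (f := fun i q => rayFlow D n (q.1 + q.2.1) (q.2.1 / rootWeight (child i q.2.2)) t
        (child i q.2.2)) ?_ fun i => ?_
    · exact (measurable_offspring.comp (measurable_snd.comp measurable_snd)).min measurable_const
    · exact ih.comp (f := fun q : ℝ × ℝ × Env S =>
        (q.1 + q.2.1, q.2.1 / rootWeight (child i q.2.2), child i q.2.2))
        (Measurable.prodMk (by fun_prop) (Measurable.prodMk
          (Measurable.div (by fun_prop) (measurable_rootWeight.comp (hc i))) (hc i)))

lemma measurable_levelSum (ht : Measurable t) (n : ℕ) : Measurable (levelSum D n t) := by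
  induction n with
  | zero => exact ht
  | succ n ih => exact measurable_kids_sum D fun i => ih.comp (measurable_child i)

lemma measurable_pairSum (ht : Measurable t) (n : ℕ) : Measurable (pairSum D n t) := by
  induction n with
  | zero => exact measurable_const
  | succ n ih =>
    refine (measurable_kids_sum D fun i => ih.comp (measurable_child i)).add ?_
    have hL := measurable_levelSum (D := D) ht n
    have hL2 : ∀ i j, Measurable fun e : Env S =>
        levelSum D n t (child i e) * levelSum D n t (child j e) := fun i j =>
      (hL.comp (measurable_child i)).mul (hL.comp (measurable_child j))
    have e : (fun e : Env S => ∑ i ∈ kids D e, ∑ j ∈ (kids D e).erase i,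
        levelSum D n t (child i e) * levelSum D n t (child j e)) = fun e => ∑ i ∈ kids D e,
          (∑ j ∈ kids D e, levelSum D n t (child i e) * levelSum D n t (child j e) -
            levelSum D n t (child i e) * levelSum D n t (child i e)) := by
      funext e
      exact Finset.sum_congr rfl fun i hi => Finset.sum_erase_eq_sub hi
    rw [e]
    exact measurable_kids_sum D fun i => (measurable_kids_sum D fun j => hL2 i j).sub (hL2 i i)

variable (p : PMF ℕ) (J : Kernel (ℕ × State S) (ℕ → State S)) [IsMarkovKernel J]
  [MeasurableSingletonClass S] {K : Kernel (State S) (State S)} [IsMarkovKernel K]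

/-- Many-to-one over n generations. The mean of t has to be the same from every state: only then
does it factor out of the mean conductance at the last generation. -/
lemma lintegral_rayFlow (hJ : HasMarginals J K) (ht : Measurable t) (ht0 : ∀ e, 0 ≤ t e)
    {q : ℝ≥0∞} (hq : ∀ y, ∫⁻ e, ENNReal.ofReal (t e) ∂(envLaw p J (Measure.dirac y)) = q) (n : ℕ)
    {a c : ℝ} (ha : 0 ≤ a) (hc : 0 < c) (y : State S) :
    ∫⁻ e, ENNReal.ofReal (rayFlow D n a c t e) ∂(envLaw p J (Measure.dirac y)) =
      q * (cutMean p D ^ n * meanCond K n a c y) := by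
  induction n generalizing a c y with
  | zero =>
    simp only [rayFlow, meanCond, pow_zero, one_mul]
    rw [← hq y, ← lintegral_mul_const _ ht.ennreal_ofReal]
    refine lintegral_congr fun e => ?_
    rw [← ENNReal.ofReal_mul (ht0 e), mul_one_div]
  | succ n ih =>
    have hr : Measurable fun e : Env S =>
        ENNReal.ofReal (rayFlow D n (a + c) (c / rootWeight e) t e) :=
      ((measurable_rayFlow (D := D) ht n).comp (f := fun e : Env S =>
        (a + c, c / rootWeight e, e)) (measurable_const.prodMk
          ((measurable_const.div measurable_rootWeight).prodMk measurable_id))).ennreal_ofReal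
    have hz : ∀ z, ∫⁻ e, ENNReal.ofReal (rayFlow D n (a + c) (c / rootWeight e) t e)
        ∂(envLaw p J (Measure.dirac z)) =
          q * cutMean p D ^ n * meanCond K n (a + c) (c / z.weight) z := by
      intro z
      rw [mul_assoc, ← ih (a := a + c) (c := c / z.weight) (by linarith)
        (div_pos hc (State.weight_pos z)) z]
      refine lintegral_congr_ae ?_
      filter_upwards [envLaw_dirac_ae_root p J z] with e he
      have : rootWeight e = z.weight := by rw [rootWeight, Env.weight, he]
      rw [this]
    calc _ = ∫⁻ e, ∑ i ∈ Finset.range (min (e.offspring []) D),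
          ENNReal.ofReal (rayFlow D n (a + c) (c / rootWeight (child i e)) t (child i e))
            ∂(envLaw p J (Measure.dirac y)) := by
          refine lintegral_congr fun e => ?_
          rw [rayFlow]
          exact ENNReal.ofReal_sum_of_nonneg fun i _ => rayFlow_nonneg ht0 n (by linarith)
            (div_pos hc (rootWeight_pos _)).le _
      _ = cutMean p D * ∫⁻ z, q * cutMean p D ^ n * meanCond K n (a + c) (c / z.weight) z ∂(K y) := by
          rw [lintegral_sum_child p J hJ D y _ hr]
          simp_rw [hz]
      _ = _ := by
          rw [lintegral_const_mul, meanCond]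
          · ring
          · exact (measurable_meanCond K n).comp (f := fun z : State S =>
              (a + c, c / z.weight, z)) (measurable_const.prodMk
                ((measurable_const.div measurable_weight).prodMk measurable_id))

include K in
lemma lintegral_levelSum_le (hJ : HasMarginals J K) (ht : Measurable t) (ht0 : ∀ e, 0 ≤ t e)
    {q : ℝ≥0∞} (hq : ∀ y, ∫⁻ e, ENNReal.ofReal (t e) ∂(envLaw p J (Measure.dirac y)) ≤ q) (n : ℕ)
    (y : State S) :
    ∫⁻ e, ENNReal.ofReal (levelSum D n t e) ∂(envLaw p J (Measure.dirac y)) ≤ (D : ℝ≥0∞) ^ n * q := by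
  induction n generalizing y with
  | zero => simpa [levelSum] using hq y
  | succ n ih =>
    calc _ = ∫⁻ e, ∑ i ∈ Finset.range (min (e.offspring []) D),
          ENNReal.ofReal (levelSum D n t (child i e)) ∂(envLaw p J (Measure.dirac y)) := by
          refine lintegral_congr fun e => ?_
          rw [levelSum]
          exact ENNReal.ofReal_sum_of_nonneg fun i _ => levelSum_nonneg ht0 n _
      _ = cutMean p D * ∫⁻ z, ∫⁻ e, ENNReal.ofReal (levelSum D n t e)
            ∂(envLaw p J (Measure.dirac z)) ∂(K y) :=
          lintegral_sum_child p J hJ D y (fun e => ENNReal.ofReal (levelSum D n t e))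
            (measurable_levelSum ht n).ennreal_ofReal
      _ ≤ D * ∫⁻ z, (D : ℝ≥0∞) ^ n * q ∂(K y) := by
          gcongr with z
          · exact cutMean_le p D
          · exact ih z
      _ = _ := by simp [pow_succ']; ring

include K in
-- A pair of vertices either lies below one child or separates at the root; in the latter case the
-- means of the two level sums multiply. The bound is quadratic in q with a constant independent of
-- t, so q can be fixed in advance.
lemma exists_lintegral_pairSum_le (hJ : HasMarginals J K) (D n : ℕ) :
    ∃ C : ℝ≥0, ∀ (t : Env S → ℝ), Measurable t → (∀ e, 0 ≤ t e) → ∀ q : ℝ≥0∞,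
      (∀ y, ∫⁻ e, ENNReal.ofReal (t e) ∂(envLaw p J (Measure.dirac y)) ≤ q) → ∀ y,
        ∫⁻ e, ENNReal.ofReal (pairSum D n t e) ∂(envLaw p J (Measure.dirac y)) ≤ C * (q * q) := by
  induction n with
  | zero => exact ⟨0, fun t _ _ q _ y => by simp [pairSum]⟩
  | succ n ih =>
    obtain ⟨C, hC⟩ := ih
    refine ⟨D * C + D * (D * (D ^ n * D ^ n)), fun t ht ht0 q hq y => ?_⟩
    have hV := (measurable_pairSum (D := D) ht n).ennreal_ofReal
    have hL := (measurable_levelSum (D := D) ht n).ennreal_ofReal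
    calc _ = ∫⁻ e, (∑ i ∈ Finset.range (min (e.offspring []) D),
          ENNReal.ofReal (pairSum D n t (child i e)) +
            ∑ i ∈ Finset.range (min (e.offspring []) D),
            ∑ j ∈ (Finset.range (min (e.offspring []) D)).erase i,
              ENNReal.ofReal (levelSum D n t (child i e)) *
                ENNReal.ofReal (levelSum D n t (child j e))) ∂(envLaw p J (Measure.dirac y)) := by
          refine lintegral_congr fun e => ?_
          rw [pairSum, ENNReal.ofReal_add (Finset.sum_nonneg fun i _ => pairSum_nonneg ht0 n _)
            (Finset.sum_nonneg fun i _ => Finset.sum_nonneg fun j _ =>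
              mul_nonneg (levelSum_nonneg ht0 n _) (levelSum_nonneg ht0 n _)),
            ENNReal.ofReal_sum_of_nonneg fun i _ => pairSum_nonneg ht0 n _,
            ENNReal.ofReal_sum_of_nonneg fun i _ => Finset.sum_nonneg fun j _ =>
              mul_nonneg (levelSum_nonneg ht0 n _) (levelSum_nonneg ht0 n _)]
          refine congrArg₂ _ rfl (Finset.sum_congr rfl fun i _ => ?_)
          rw [ENNReal.ofReal_sum_of_nonneg fun j _ =>
            mul_nonneg (levelSum_nonneg ht0 n _) (levelSum_nonneg ht0 n _)]
          exact Finset.sum_congr rfl fun j _ => ENNReal.ofReal_mul (levelSum_nonneg ht0 n _)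
      _ ≤ cutMean p D * ∫⁻ z, ∫⁻ e, ENNReal.ofReal (pairSum D n t e)
            ∂(envLaw p J (Measure.dirac z)) ∂(K y) +
            D * (D * (((D : ℝ≥0∞) ^ n * q) * ((D : ℝ≥0∞) ^ n * q))) := by
          rw [lintegral_add_left]
          · refine add_le_add (le_of_eq ?_) ?_
            · exact lintegral_sum_child p J hJ D y (fun e => ENNReal.ofReal (pairSum D n t e)) hV
            · exact lintegral_sum_child_mul_le p J D y (fun e => ENNReal.ofReal (levelSum D n t e))
                hL fun z => lintegral_levelSum_le p J hJ ht ht0 hq n z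
          · exact measurable_kids_sum D fun i => hV.comp (measurable_child i)
      _ ≤ D * ∫⁻ z, C * (q * q) ∂(K y) +
            D * (D * (((D : ℝ≥0∞) ^ n * q) * ((D : ℝ≥0∞) ^ n * q))) := by
          gcongr with z
          · exact cutMean_le p D
          · exact hC t ht ht0 q hq z
      _ = _ := by
          simp only [lintegral_const, measure_univ, mul_one]
          push_cast
          ring

/-- If the mean number of successful vertices of generation `n` is at least `2` from every state,
then the mean escape probabilities are bounded from below. -/
lemma exists_lintegral_escapeProb_ge (hJ : HasMarginals J K) {D n : ℕ}
    (hn : ∀ y, 2 ≤ cutMean p D ^ n * meanCond K n 0 1 y) :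
    ∃ q : ℝ≥0∞, q ≠ 0 ∧ ∀ (k : ℕ) (y : State S),
      q ≤ ∫⁻ e, ENNReal.ofReal (escapeProb D (n * k) 1 e) ∂(envLaw p J (Measure.dirac y)) := by
  obtain ⟨C, hC⟩ := exists_lintegral_pairSum_le p J hJ D n
  -- Small enough for the pair correction C q² to be at most q.
  set q : ℝ≥0∞ := ((C : ℝ≥0∞) + 1)⁻¹
  have hq0 : q ≠ 0 := ENNReal.inv_ne_zero.2 (by simp)
  have hq1 : q ≤ 1 := ENNReal.inv_le_one.2 le_add_self
  have hqtop : q ≠ ⊤ := ne_top_of_le_ne_top ENNReal.one_ne_top hq1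
  have hCq : (C : ℝ≥0∞) * (q * q) ≤ q := by
    calc (C : ℝ≥0∞) * (q * q) = (C * q) * q := by ring
      _ ≤ (((C : ℝ≥0∞) + 1) * q) * q := by gcongr; exact le_self_add
      _ = 1 * q := by rw [ENNReal.mul_inv_cancel (by simp) (by simp)]
      _ = q := one_mul q
  refine ⟨q, hq0, fun k => ?_⟩
  have h1 : ∀ e : Env S, (0 : ℝ) ≤ (1 : Env S → ℝ) e := fun _ => zero_le_one
  induction k with
  | zero => intro y; simpa [escapeProb] using hq1
  | succ k ih =>
    intro y
    set u : Env S → ℝ := escapeProb D (n * k) 1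
    have hu : Measurable u := measurable_escapeProb measurable_one _
    have hu0 : ∀ e, 0 ≤ u e := escapeProb_nonneg h1 _
    have hu1 : ∀ e, u e ≤ 1 := escapeProb_le_one h1 (fun _ => le_rfl) _
    let U : State S → ℝ≥0∞ := fun y => ∫⁻ e, ENNReal.ofReal (u e) ∂(envLaw p J (Measure.dirac y))
    have hU : Measurable U := measurable_lintegral_envLaw_dirac p J _ hu.ennreal_ofReal
    have hU0 : ∀ y, U y ≠ 0 := fun y h => hq0 (le_zero_iff.1 (h ▸ ih y))
    have hU1 : ∀ y, U y ≤ 1 := fun y => by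
      calc U y ≤ ∫⁻ _, 1 ∂(envLaw p J (Measure.dirac y)) :=
            lintegral_mono fun e => ENNReal.ofReal_le_one.2 (hu1 e)
        _ = 1 := by simp
    have hUtop : ∀ y, U y ≠ ⊤ := fun y => ne_top_of_le_ne_top ENNReal.one_ne_top (hU1 y)
    have hdiv1 : ∀ y, q / U y ≤ 1 := fun y => ENNReal.div_le_of_le_mul (by rw [one_mul]; exact ih y)
    have hdivtop : ∀ y, q / U y ≠ ⊤ := fun y => ne_top_of_le_ne_top ENNReal.one_ne_top (hdiv1 y)
    -- Thinning by the root state: by the induction hypothesis the factor is at most 1, and the mean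
    -- becomes exactly q from every state, as `lintegral_rayFlow` requires.
    let t : Env S → ℝ := fun e => (q / U (e []).2).toReal * u e
    have ht : Measurable t := ((measurable_const.div hU).comp
      (measurable_snd.comp (measurable_pi_apply []))).ennreal_toReal.mul hu
    have ht0 : ∀ e, 0 ≤ t e := fun e => mul_nonneg ENNReal.toReal_nonneg (hu0 e)
    have htu : ∀ e, t e ≤ u e := fun e => mul_le_of_le_one_left (hu0 e)
      (ENNReal.toReal_le_of_le_ofReal zero_le_one (by simpa using hdiv1 _))
    have htq : ∀ y, ∫⁻ e, ENNReal.ofReal (t e) ∂(envLaw p J (Measure.dirac y)) = q := by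
      intro y
      calc _ = ∫⁻ e, q / U y * ENNReal.ofReal (u e) ∂(envLaw p J (Measure.dirac y)) := by
            refine lintegral_congr_ae ?_
            filter_upwards [envLaw_dirac_ae_root p J y] with e he
            simp only [t]
            rw [ENNReal.ofReal_mul ENNReal.toReal_nonneg, ENNReal.ofReal_toReal (hdivtop _), he]
        _ = q / U y * U y := lintegral_const_mul _ hu.ennreal_ofReal
        _ = q := ENNReal.div_mul_cancel (hU0 y) (hUtop y)
    -- Of the mean flow 2q, at most q is lost to the pair sum. Monotonicity in t then replaces the
    -- thinned success probability by the true one.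
    have hkey : q + q ≤ ∫⁻ e, ENNReal.ofReal (escapeProb D (n * (k + 1)) 1 e)
        ∂(envLaw p J (Measure.dirac y)) + q := by
      calc q + q = q * 2 := (mul_two q).symm
        _ ≤ q * (cutMean p D ^ n * meanCond K n 0 1 y) := by gcongr; exact hn y
        _ = ∫⁻ e, ENNReal.ofReal (rayFlow D n 0 1 t e) ∂(envLaw p J (Measure.dirac y)) :=
            (lintegral_rayFlow p J hJ ht ht0 htq n le_rfl one_pos y).symm
        _ ≤ ∫⁻ e, (ENNReal.ofReal (escapeProb D n t e) + ENNReal.ofReal (pairSum D n t e))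
              ∂(envLaw p J (Measure.dirac y)) := by
            refine lintegral_mono fun e => ?_
            rw [← ENNReal.ofReal_add (escapeProb_nonneg ht0 n e) (pairSum_nonneg ht0 n e)]
            exact ENNReal.ofReal_le_ofReal
              (rayFlow_le_escapeProb_add ht0 (fun e => (htu e).trans (hu1 e)) n e)
        _ = ∫⁻ e, ENNReal.ofReal (escapeProb D n t e) ∂(envLaw p J (Measure.dirac y)) +
              ∫⁻ e, ENNReal.ofReal (pairSum D n t e) ∂(envLaw p J (Measure.dirac y)) :=
            lintegral_add_left (measurable_escapeProb ht n).ennreal_ofReal _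
        _ ≤ _ := by
            refine add_le_add (lintegral_mono fun e => ENNReal.ofReal_le_ofReal ?_)
              ((hC t ht ht0 q (fun y => (htq y).le) y).trans hCq)
            rw [mul_add, mul_one, escapeProb_add]
            exact escapeProb_mono ht0 htu n e
    exact (ENNReal.add_le_add_iff_right hqtop).1 hkey

end MeanEscape

/-! ### Escape from the root of the infinite tree -/

section Escape

variable {S : Type*}

lemma escapeProb_one_antitone (D : ℕ) (e : Env S) :
    Antitone fun m => escapeProb D m (1 : Env S → ℝ) e := by
  have h1 : ∀ e : Env S, (0 : ℝ) ≤ (1 : Env S → ℝ) e := fun _ => zero_le_one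
  refine antitone_nat_of_succ_le fun m => ?_
  rw [add_comm, escapeProb_add]
  exact escapeProb_mono (escapeProb_nonneg h1 1)
    (fun e => escapeProb_le_one h1 (fun _ => le_rfl) 1 e) m e

/-- The probability that the walk started at the root of the tree in which each vertex keeps its
first `D` children never visits the parent of the root. -/
noncomputable def escapeLim (D : ℕ) (e : Env S) : ℝ := ⨅ m, escapeProb D m (1 : Env S → ℝ) e

lemma tendsto_escapeProb (D : ℕ) (e : Env S) :
    Tendsto (fun m => escapeProb D m (1 : Env S → ℝ) e) atTop (𝓝 (escapeLim D e)) :=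
  tendsto_atTop_ciInf (escapeProb_one_antitone D e)
    ⟨0, by rintro _ ⟨m, rfl⟩; exact escapeProb_nonneg (fun _ => zero_le_one) m e⟩

lemma escapeLim_nonneg (D : ℕ) (e : Env S) : 0 ≤ escapeLim D e :=
  ge_of_tendsto' (tendsto_escapeProb D e) fun m => escapeProb_nonneg (fun _ => zero_le_one) m e

lemma escapeLim_le_one (D : ℕ) (e : Env S) : escapeLim D e ≤ 1 :=
  le_of_tendsto' (tendsto_escapeProb D e) fun m =>
    escapeProb_le_one (fun _ => zero_le_one) (fun _ => le_rfl) m e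

/-- The total conductance from the root to infinity of the tree in which each vertex keeps its
first `D` children. -/
noncomputable def escapeCond (D : ℕ) (e : Env S) : ℝ :=
  ∑ i ∈ kids D e, rootWeight (child i e) * escapeLim D (child i e)

lemma escapeCond_nonneg (D : ℕ) (e : Env S) : 0 ≤ escapeCond D e :=
  Finset.sum_nonneg fun _ _ => mul_nonneg (rootWeight_pos _).le (escapeLim_nonneg D _)

lemma escapeLim_eq (D : ℕ) (e : Env S) :
    escapeLim D e = escapeCond D e / (1 + escapeCond D e) := by
  have h : Tendsto (fun m => ∑ i ∈ kids D e,
      rootWeight (child i e) * escapeProb D m (1 : Env S → ℝ) (child i e)) atTop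
      (𝓝 (escapeCond D e)) :=
    tendsto_finsetSum _ fun i _ => (tendsto_escapeProb D (child i e)).const_mul _
  have h0 := escapeCond_nonneg D e
  exact tendsto_nhds_unique ((tendsto_add_atTop_iff_nat 1).2 (tendsto_escapeProb D e))
    (h.div (h.const_add 1) (by linarith))

/-- The environment seen from `ν`. -/
def subtree (e : Env S) (ν : List ℕ) : Env S := fun μ => e (μ ++ ν)

lemma subtree_nil (e : Env S) : subtree e [] = e := by
  funext μ; simp [subtree]

lemma child_subtree (e : Env S) (ν : List ℕ) (i : ℕ) :
    child i (subtree e ν) = subtree e (i :: ν) := by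
  funext μ; simp [subtree, child]

lemma rootWeight_subtree (e : Env S) (ν : List ℕ) : rootWeight (subtree e ν) = e.weight ν := rfl

lemma kids_subtree (e : Env S) (ν : List ℕ) (D : ℕ) :
    kids D (subtree e ν) = Finset.range (min (e.offspring ν) D) := rfl

lemma escapeCond_subtree_le (D : ℕ) (e : Env S) (ν : List ℕ) :
    escapeCond D (subtree e ν) ≤
      ∑ i ∈ Finset.range (e.offspring ν), e.weight (i :: ν) * escapeLim D (subtree e (i :: ν)) := by
  unfold escapeCond
  simp only [child_subtree, rootWeight_subtree, kids_subtree]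
  exact Finset.sum_le_sum_of_subset_of_nonneg (Finset.range_mono (min_le_left _ _)) fun i _ _ =>
    mul_nonneg (State.weight_pos _).le (escapeLim_nonneg D _)

/-- A lower bound for the probability that the walk started at `ν` never visits the root. -/
noncomputable def avoidProb (D : ℕ) (e : Env S) : List ℕ → ℝ
  | [] => 0
  | i :: ν => escapeLim D (subtree e (i :: ν)) +
      (1 - escapeLim D (subtree e (i :: ν))) * avoidProb D e ν

lemma avoidProb_nonneg (D : ℕ) (e : Env S) (ν : List ℕ) : 0 ≤ avoidProb D e ν := by
  induction ν with
  | nil => exact le_rfl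
  | cons i ν ih =>
    exact add_nonneg (escapeLim_nonneg _ _) (mul_nonneg (sub_nonneg.2 (escapeLim_le_one _ _)) ih)

lemma avoidProb_le_one (D : ℕ) (e : Env S) (ν : List ℕ) : avoidProb D e ν ≤ 1 := by
  induction ν with
  | nil => exact zero_le_one
  | cons i ν ih =>
    rw [avoidProb]
    nlinarith [escapeLim_nonneg D (subtree e (i :: ν)), escapeLim_le_one D (subtree e (i :: ν))]

/-- The extension of `avoidProb` to the augmented tree. -/
noncomputable def Site.avoidProb (D : ℕ) (e : Env S) : Site → ℝ
  | Site.rootParent => 0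
  | Site.vertex ν => TreeWalk.avoidProb D e ν

lemma Site.avoidProb_nonneg (D : ℕ) (e : Env S) (v : Site) : 0 ≤ Site.avoidProb D e v := by
  cases v with
  | rootParent => exact le_rfl
  | vertex ν => exact TreeWalk.avoidProb_nonneg D e ν

lemma lintegral_stepLaw_vertex (e : Env S) (ν : List ℕ) (g : Site → ℝ) (hg : ∀ v, 0 ≤ g v) :
    ∫⁻ v, ENNReal.ofReal (g v) ∂(stepLaw e (Site.vertex ν)) =
      ENNReal.ofReal ((g (Site.parent ν) + ∑ i ∈ Finset.range (e.offspring ν),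
        e.weight (i :: ν) * g (Site.vertex (i :: ν))) / e.total ν) := by
  have h0 := e.total_pos ν
  have hw : ∀ i, 0 ≤ e.weight (i :: ν) := fun i => (State.weight_pos _).le
  have hd : ∀ v : Site, ∫⁻ w, ENNReal.ofReal (g w) ∂(Measure.dirac v) = ENNReal.ofReal (g v) :=
    fun v => lintegral_dirac' _ measurable_from_top
  simp only [stepLaw, lintegral_add_measure, lintegral_smul_measure, lintegral_finsetSum_measure,
    smul_eq_mul, hd]
  have h1 : ∀ i ∈ Finset.range (e.offspring ν),
      ENNReal.ofReal (e.weight (i :: ν) / e.total ν) * ENNReal.ofReal (g (Site.vertex (i :: ν))) =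
        ENNReal.ofReal (e.weight (i :: ν) * g (Site.vertex (i :: ν)) / e.total ν) := fun i _ => by
    rw [← ENNReal.ofReal_mul (div_nonneg (hw i) h0.le), div_mul_eq_mul_div]
  rw [Finset.sum_congr rfl h1, ← ENNReal.ofReal_mul (by positivity),
    ← ENNReal.ofReal_sum_of_nonneg fun i _ => div_nonneg (mul_nonneg (hw i) (hg _)) h0.le,
    ← ENNReal.ofReal_add (mul_nonneg (by positivity) (hg _))
      (Finset.sum_nonneg fun i _ => div_nonneg (mul_nonneg (hw i) (hg _)) h0.le),
    ← Finset.sum_div, add_div, one_div_mul_eq_div]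

/-- The quenched probability never to return to the root is at least the conductance to infinity
divided by the total conductance at the root. -/
lemma le_quenchedLaw (D : ℕ) (e : Env S) :
    ENNReal.ofReal (escapeCond D e / e.total []) ≤
      quenchedLaw e {X | ∀ n : ℕ, 1 ≤ n → X n ≠ Site.vertex []} := by
  have : DiscreteMeasurableSpace Site := ⟨fun _ => trivial⟩
  have hg := Site.avoidProb_nonneg D e
  refine le_trans ?_ (le_chainLaw_no_return (stepKernel e) (Site.vertex [])
    (fun v => ENNReal.ofReal (Site.avoidProb D e v)) (fun v => ?_) ?_ fun v hv => ?_)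
  · change _ ≤ ∫⁻ v, _ ∂(stepLaw e (Site.vertex []))
    rw [lintegral_stepLaw_vertex e [] _ hg]
    refine ENNReal.ofReal_le_ofReal (div_le_div_of_nonneg_right ?_ (e.total_pos []).le)
    have h := escapeCond_subtree_le D e []
    rw [subtree_nil] at h
    simpa [Site.avoidProb, Site.parent, avoidProb] using h
  · rw [ENNReal.ofReal_le_one]
    cases v with
    | rootParent => exact zero_le_one
    | vertex ν => exact avoidProb_le_one D e ν
  · simp [Site.avoidProb, avoidProb]
  -- Subharmonicity off the root. In the cut tree `avoidProb` is harmonic there, which is the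
  -- content of `hB1`. Children beyond the first D have values at least f, so their presence can
  -- only raise the average.
  · cases v with
    | rootParent => simp [Site.avoidProb]
    | vertex ν =>
      change _ ≤ ∫⁻ v, _ ∂(stepLaw e (Site.vertex ν))
      rw [lintegral_stepLaw_vertex e ν _ hg]
      refine ENNReal.ofReal_le_ofReal ?_
      cases ν with
      | nil => exact absurd rfl hv
      | cons i π =>
        rw [le_div_iff₀ (e.total_pos _)]
        simp only [Site.avoidProb, Site.parent]
        have hB := escapeCond_subtree_le D e (i :: π)
        have hB0 := escapeCond_nonneg D (subtree e (i :: π))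
        have hlim := escapeLim_eq D (subtree e (i :: π))
        have hf1 := avoidProb_le_one D e (i :: π)
        have hfeq : avoidProb D e (i :: π) = escapeLim D (subtree e (i :: π)) +
          (1 - escapeLim D (subtree e (i :: π))) * avoidProb D e π := rfl
        set B := escapeCond D (subtree e (i :: π))
        set f := avoidProb D e (i :: π)
        have hB1 : (1 + B) * f = B + avoidProb D e π := by
          rw [hfeq, hlim]
          have : 1 + B ≠ 0 := by linarith
          field_simp
          ring
        have hsum : ∑ j ∈ Finset.range (e.offspring (i :: π)),
            e.weight (j :: i :: π) * avoidProb D e (j :: i :: π) =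
            (∑ j ∈ Finset.range (e.offspring (i :: π)), e.weight (j :: i :: π)) * f +
            (∑ j ∈ Finset.range (e.offspring (i :: π)),
              e.weight (j :: i :: π) * escapeLim D (subtree e (j :: i :: π))) * (1 - f) := by
          rw [Finset.sum_mul, Finset.sum_mul, ← Finset.sum_add_distrib]
          refine Finset.sum_congr rfl fun j _ => ?_
          rw [avoidProb]
          ring
        rw [hsum, Env.total]
        nlinarith [mul_le_mul_of_nonneg_right hB (sub_nonneg.2 hf1)]

end Escape

/-! ### From mean escape probabilities to transience. -/

section Transience

variable {S : Type*} [MeasurableSpace S]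

lemma measurable_escapeLim (D : ℕ) : Measurable (escapeLim D : Env S → ℝ) :=
  Measurable.iInf fun m => measurable_escapeProb measurable_one m

lemma measurable_escapeCond (D : ℕ) : Measurable (escapeCond D : Env S → ℝ) :=
  measurable_kids_sum D fun i => (measurable_rootWeight.comp (measurable_child i)).mul
    ((measurable_escapeLim D).comp (measurable_child i))

lemma measurable_total : Measurable fun e : Env S => e.total [] :=
  measurable_const.add (measurable_sum_range measurable_offspring fun i =>
    measurable_weight.comp (measurable_snd.comp (measurable_pi_apply [i])))

/-- If return were almost sure, `le_quenchedLaw` would make the conductance to infinity vanish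
almost surely, and with it `escapeLim`, by the fixed-point equation `escapeLim_eq`. -/
lemma isTransient_of_lintegral_escapeLim_ne_zero (P : Measure (Env S)) (D : ℕ)
    (h : ∫⁻ e, ENNReal.ofReal (escapeLim D e) ∂P ≠ 0) : IsTransient P := by
  have hm : Measurable fun e : Env S => ENNReal.ofReal (escapeCond D e / e.total []) :=
    ((measurable_escapeCond D).div measurable_total).ennreal_ofReal
  refine lt_of_lt_of_le (pos_iff_ne_zero.2 fun h0 => h ?_) (lintegral_mono fun e => le_quenchedLaw D e)
  rw [lintegral_eq_zero_iff hm] at h0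
  refine (lintegral_congr_ae ?_).trans lintegral_zero
  filter_upwards [h0] with e he
  have he : escapeCond D e / e.total [] ≤ 0 := ENNReal.ofReal_eq_zero.1 he
  have h1 : escapeCond D e ≤ 0 := by
    by_contra hc
    exact absurd (div_pos (not_le.1 hc) (e.total_pos [])) (not_lt.2 he)
  rw [escapeLim_eq, le_antisymm h1 (escapeCond_nonneg D e)]
  simp

lemma lintegral_escapeLim_ge (P : Measure (Env S)) [IsProbabilityMeasure P] (D : ℕ) {n : ℕ}
    (hn : n ≠ 0) {q : ℝ≥0∞}
    (h : ∀ k, q ≤ ∫⁻ e, ENNReal.ofReal (escapeProb D (n * k) 1 e) ∂P) :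
    q ≤ ∫⁻ e, ENNReal.ofReal (escapeLim D e) ∂P := by
  have hlim : Tendsto (fun k => ∫⁻ e, ENNReal.ofReal (escapeProb D (n * k) 1 e) ∂P) atTop
      (𝓝 (∫⁻ e, ENNReal.ofReal (escapeLim D e) ∂P)) := by
    refine tendsto_lintegral_of_dominated_convergence (fun _ => 1)
      (fun k => (measurable_escapeProb measurable_one _).ennreal_ofReal)
      (fun k => ae_of_all _ fun e => ENNReal.ofReal_le_one.2
        (escapeProb_le_one (fun _ => zero_le_one) (fun _ => le_rfl) _ e)) (by simp)
      (ae_of_all _ fun e => (ENNReal.continuous_ofReal.tendsto _).comp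
        ((tendsto_escapeProb D e).comp ?_))
    exact tendsto_id.const_mul_atTop' (Nat.pos_of_ne_zero hn)
  exact ge_of_tendsto' hlim h

lemma iSup_cutMean (p : PMF ℕ) {b : ℝ} (hb : HasSum (fun k : ℕ => (k : ℝ) * (p k).toReal) b) :
    ⨆ D, cutMean p D = ENNReal.ofReal b := by
  have h1 : ⨆ D, cutMean p D = ∫⁻ k, (k : ℝ≥0∞) ∂p.toMeasure := by
    unfold cutMean
    rw [← lintegral_iSup (fun D => measurable_of_countable _)]
    · refine lintegral_congr fun k => le_antisymm (iSup_le fun D => ?_) ?_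
      · exact Nat.cast_le.2 (min_le_left k D)
      · exact le_iSup_of_le k (by rw [min_self])
    · intro D D' h k
      exact Nat.cast_le.2 (min_le_min_left k h)
  rw [h1, lintegral_countable']
  have h2 : ∀ k : ℕ, (k : ℝ≥0∞) * p.toMeasure {k} = ENNReal.ofReal ((k : ℝ) * (p k).toReal) := by
    intro k
    rw [PMF.toMeasure_apply_singleton _ _ (measurableSet_singleton k),
      ENNReal.ofReal_mul (Nat.cast_nonneg k), ENNReal.ofReal_natCast,
      ENNReal.ofReal_toReal (p.apply_ne_top k)]
  simp_rw [h2]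
  rw [← ENNReal.ofReal_tsum_of_nonneg (fun k => by positivity) hb.summable, hb.tsum_eq]

end Transience

end TreeWalk

/-! ### Choice of the parameters and conclusion. -/

theorem mainTheorem6 {S : Type*} [TopologicalSpace S] [PolishSpace S] [MeasurableSpace S]
    [BorelSpace S]
    (p : PMF ℕ) (b : ℝ) (hb : HasSum (fun k : ℕ => (k : ℝ) * (p k).toReal) b) (hb1 : 1 < b)
    (K : Kernel (TreeWalk.State S) (TreeWalk.State S)) [IsMarkovKernel K]
    (J : Kernel (ℕ × TreeWalk.State S) (ℕ → TreeWalk.State S)) [IsMarkovKernel J]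
    (hJ : TreeWalk.HasMarginals J K)
    (μ₀ : Measure (TreeWalk.State S)) [IsProbabilityMeasure μ₀]
    (ℓ N : ℕ) (κ : ℝ≥0) (h1 : TreeWalk.Assumption1 K ℓ N κ) (h2 : TreeWalk.Assumption2 K)
    (xstar : TreeWalk.State S) (hx : 1 ≤ xstar.weight)
    (hlim : ((-Real.log b : ℝ) : EReal) <
      liminf (fun n : ℕ => (((1 : ℝ) / n : ℝ) : EReal) *
        TreeWalk.meanLogHit K n ((K ^ ℓ) xstar)) atTop) :
    TreeWalk.IsTransient (TreeWalk.envLaw p J μ₀) := by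
  obtain ⟨t, ht, c, hc0, hc⟩ := TreeWalk.exists_exp_lower_bound h1 h2 xstar hlim
  have hexp : ENNReal.ofReal (Real.exp t) < ⨆ D, TreeWalk.cutMean p D := by
    rw [TreeWalk.iSup_cutMean p hb, ENNReal.ofReal_lt_ofReal_iff (by linarith)]
    exact (Real.lt_log_iff_exp_lt (by linarith)).1 ht
  -- Cutting at a large D keeps the mean above exp t, because exp t < b. It also makes the number of
  -- pairs bounded, which the second-moment estimate needs as the offspring law has only a finite
  -- mean.
  obtain ⟨D, hD⟩ := lt_iSup_iff.1 hexp
  set r : ℝ≥0∞ := TreeWalk.cutMean p D * ENNReal.ofReal (Real.exp (-t)) with hr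
  have hr1 : 1 < r := by
    have h3 : ENNReal.ofReal (Real.exp t) * ENNReal.ofReal (Real.exp (-t)) = 1 := by
      rw [← ENNReal.ofReal_mul (Real.exp_pos t).le, ← Real.exp_add]
      simp
    rw [← h3]
    exact ENNReal.mul_lt_mul_left (by simpa using Real.exp_pos _) (by simp) hD
  have htop : Tendsto (fun n : ℕ => c * r ^ n) atTop (𝓝 ⊤) := by
    have := ENNReal.Tendsto.const_mul (a := c) (ENNReal.tendsto_pow_atTop_nhds_top_iff.2 hr1)
      (Or.inl (by simp))
    rwa [ENNReal.mul_top hc0] at this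
  -- The factor 2 leaves one q after the pair correction has taken the other; n ≠ 0 makes the depths
  -- n k tend to infinity.
  obtain ⟨n, hn, hn2, hn0⟩ := (hc.and ((htop.eventually (lt_mem_nhds (show (2 : ℝ≥0∞) < ⊤ by simp))).and
    (eventually_ne_atTop 0))).exists
  have hmean : ∀ y, 2 ≤ TreeWalk.cutMean p D ^ n * TreeWalk.meanCond K n 0 1 y := by
    intro y
    calc (2 : ℝ≥0∞) ≤ c * r ^ n := hn2.le
      _ = TreeWalk.cutMean p D ^ n * (c * ENNReal.ofReal (Real.exp (-t * n))) := by
          rw [hr, mul_pow, ← ENNReal.ofReal_pow (Real.exp_pos _).le, ← Real.exp_nat_mul,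
            mul_comm (n : ℝ)]
          ring
      _ ≤ _ := by gcongr; exact hn y
  obtain ⟨q, hq0, hq⟩ := TreeWalk.exists_lintegral_escapeProb_ge p J hJ hmean
  refine TreeWalk.isTransient_of_lintegral_escapeLim_ne_zero _ D fun h0 => hq0 (le_zero_iff.1 ?_)
  rw [← h0]
  refine TreeWalk.lintegral_escapeLim_ge _ D hn0 fun k => ?_
  rw [TreeWalk.lintegral_envLaw_eq p J μ₀ _
    (TreeWalk.measurable_escapeProb measurable_one _).ennreal_ofReal]
  calc q = ∫⁻ _, q ∂μ₀ := by simp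
    _ ≤ _ := lintegral_mono fun y => hq k y
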